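/- **Setting.** An instance of the evacuation scheduling problem consists of a finite directed graph whose node set is the disjoint union of evacuation nodes $\mathcal E$, transit nodes and safe nodes; for every arc $e$ a travel time $t_e\in\mathbb Q_{\ge0}$, a capacity $u_e\in\mathbb Q_{\ge0}$ and a time $f_e\in\mathbb Q_{\ge0}\cup\{\infty\}$ at which it becomes unavailable; a number $d_k\in\mathbb N$ of evacuees for every $k\in\mathcal E$; a horizon $\mathcal H\in\mathbb N$; and for every $k\in\mathcal E$ one evacuation path $p_k$, a simple path from $k$ to a safe node. Travel times are rounded up arc by arc: for a node $n$ of $p_k$, let $t_{k,n}$ be the sum of $\lceil t_e\rceil$ over the arcs $e$ of $p_k$ between $k$ and $n$, and let $t_{p_k}$ be the total over $p_k$. Let $u_{p_k}=\min_{e\in p_k}u_e$, $\mathrm{lastdep}(p_k)=\min_{e\in p_k}(f_e-t_{k,\mathrm{head}(e)})$ (possibly $\infty$), and $b_k=\min(\mathcal H-t_{p_k},\lfloor\mathrm{lastdep}(p_k)\rfloor)\in\mathbb Z$. The model NPEPP-MF asks for natural numbers $\mathit{flow}_k\in[0,d_k]$, $\mathit{rate}_k\in[1,\min(d_k,\lfloor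 u_{p_k}\rfloor)]$, $\mathit{start}_k,\mathit{end}_k\in[0,b_k]$ and $\mathit{dur}_k\in[0,d_k]$ for all $k\in\mathcal E$, which maximize $\sum_{k}\mathit{flow}_k$ subject to $\mathit{start}_k+\mathit{dur}_k=\mathit{end}_k$, $\mathit{flow}_k=\min(\mathit{dur}_k\cdot\mathit{rate}_k,\,d_k)$ and $\mathit{rate}_k=\min(d_k,\lfloor u_{p_k}\rfloor)$ for all $k$, and subject to the condition that for every arc $e$ and any two distinct areas $k,l$ whose paths contain $e$, the tasks do not overlap on $e$, i.e. $\mathit{end}_k+t_{k,\mathrm{tail}(e)}\le\mathit{start}_l+t_{l,\mathrm{tail}(e)}$ or $\mathit{end}_l+t_{l,\mathrm{tail}(e)}\le\mathit{start}_k+t_{k,\mathrm{tail}(e)}$. The evacuation paths are *convergent* if they have no forks, i.e. together they form a forest of trees rooted at safe nodes: no node is left by two different arcs of evacuation paths, and no safe node is left by an arc of an evacuation path. The *latest completion time* of $p_k$ at its safe node is $b_k+t_{p_k}$. **Theorem.** The model NPEPP-MF can be solved in polynomial time on the instances whose evacuation paths are convergent and in which all evacuation paths ending at the same safe node share the same latest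 completion time there (in particular, on the instances with convergent paths in which all evacuation paths share the same latest completion time). That is, there are a program of a random access machine with logarithmic cost and a polynomial $q$ such that on every such instance, given as a list of natural numbers in binary of total length $N$, the program halts after time at most $q(N)$ and outputs an optimal solution, or correctly reports that there is no feasible solution. -/

import Mathlib

/-! ## Random access machines with logarithmic cost -/

namespace Ram

/-- Programs of a random access machine with finitely many registers per program, an unbounded
memory with indirect addressing, the arithmetic instructions `+`, `-` (truncated), `*`, `/`
(integer division), and structured control flow. Registers and memory cells hold natural numbers
of arbitrary size. -/
inductive Prog : Type
  /-- do nothing -/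
  | skip : Prog
  /-- `r := c` for a constant `c` -/
  | const (r c : ℕ) : Prog
  /-- `r := a + b` -/
  | add (r a b : ℕ) : Prog
  /-- `r := a - b`, and `0` if `a < b` -/
  | sub (r a b : ℕ) : Prog
  /-- `r := a * b` -/
  | mul (r a b : ℕ) : Prog
  /-- `r := a / b` rounded down, and `0` if `b = 0` -/
  | div (r a b : ℕ) : Prog
  /-- `r := mem[a]` -/
  | load (r a : ℕ) : Prog
  /-- `mem[a] := b` -/
  | store (a b : ℕ) : Prog
  /-- first `p`, then `q` -/
  | seq (p q : Prog) : Prog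
  /-- if register `r` is nonzero then `p`, else `q` -/
  | ite (r : ℕ) (p q : Prog) : Prog
  /-- as long as register `r` is nonzero, do `p` -/
  | loop (r : ℕ) (p : Prog) : Prog

/-- The contents of the registers and of the memory. -/
structure State : Type where
  /-- registers -/
  reg : ℕ → ℕ
  /-- memory cells -/
  mem : ℕ → ℕ

/-- Write `v` into register `r`. -/
def State.setReg (s : State) (r v : ℕ) : State := ⟨Function.update s.reg r v, s.mem⟩

/-- Write `v` into memory cell `a`. -/
def State.setMem (s : State) (a v : ℕ) : State := ⟨s.reg, Function.update s.mem a v⟩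

/-- `Exec p s s' t`: the program `p`, started in state `s`, halts in state `s'` after time `t`,
where every instruction and every test costs one plus the binary lengths (`Nat.size`) of the
numbers and of the memory address it handles. -/
inductive Exec : Prog → State → State → ℕ → Prop
  | skip (s : State) : Exec .skip s s 1
  | const (s : State) (r c : ℕ) : Exec (.const r c) s (s.setReg r c) (1 + c.size)
  | add (s : State) (r a b : ℕ) :
      Exec (.add r a b) s (s.setReg r (s.reg a + s.reg b))
        (1 + (s.reg a).size + (s.reg b).size)
  | sub (s : State) (r a b : ℕ) :
      Exec (.sub r a b) s (s.setReg r (s.reg a - s.reg b))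
        (1 + (s.reg a).size + (s.reg b).size)
  | mul (s : State) (r a b : ℕ) :
      Exec (.mul r a b) s (s.setReg r (s.reg a * s.reg b))
        (1 + (s.reg a).size + (s.reg b).size)
  | div (s : State) (r a b : ℕ) :
      Exec (.div r a b) s (s.setReg r (s.reg a / s.reg b))
        (1 + (s.reg a).size + (s.reg b).size)
  | load (s : State) (r a : ℕ) :
      Exec (.load r a) s (s.setReg r (s.mem (s.reg a)))
        (1 + (s.reg a).size + (s.mem (s.reg a)).size)
  | store (s : State) (a b : ℕ) :
      Exec (.store a b) s (s.setMem (s.reg a) (s.reg b))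
        (1 + (s.reg a).size + (s.reg b).size)
  | seq {p q : Prog} {s s' s'' : State} {t t' : ℕ} :
      Exec p s s' t → Exec q s' s'' t' → Exec (.seq p q) s s'' (t + t')
  | ite_true {r : ℕ} {p q : Prog} {s s' : State} {t : ℕ} :
      s.reg r ≠ 0 → Exec p s s' t → Exec (.ite r p q) s s' (1 + (s.reg r).size + t)
  | ite_false {r : ℕ} {p q : Prog} {s s' : State} {t : ℕ} :
      s.reg r = 0 → Exec q s s' t → Exec (.ite r p q) s s' (1 + (s.reg r).size + t)
  | loop_done {r : ℕ} {p : Prog} {s : State} :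
      s.reg r = 0 → Exec (.loop r p) s s (1 + (s.reg r).size)
  | loop_step {r : ℕ} {p : Prog} {s s' s'' : State} {t t' : ℕ} :
      s.reg r ≠ 0 → Exec p s s' t → Exec (.loop r p) s' s'' t' →
        Exec (.loop r p) s s'' (1 + (s.reg r).size + t + t')

/-- The initial state on the input `x`: the numbers of `x` are in the memory cells
`0, 1, …, x.length - 1`, register `0` holds `x.length`, everything else is `0`. -/
def init (x : List ℕ) : State where
  reg := fun r => if r = 0 then x.length else 0
  mem := fun a => x.getD a 0

/-- The output: the first `n` memory cells, where `n` is the content of register `0`. -/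
def State.output (s : State) : List ℕ := (List.range (s.reg 0)).map s.mem

/-- The size of an input: the total binary length of its numbers, with one separator each. -/
def inputSize (x : List ℕ) : ℕ := (x.map fun n => n.size + 1).sum

/-- The search problem "given an instance `a` with `P a`, find a `b` with `R a b`" can be solved
in polynomial time: one program finds, on every such instance, an answer in time bounded by a
fixed polynomial in the size of the (binary) encoding of the instance. -/
def SolvableInPolyTime {α β : Type} (encIn : α → List ℕ) (encOut : β → List ℕ)
    (P : α → Prop) (R : α → β → Prop) : Prop :=
  ∃ (prog : Prog) (bound : Polynomial ℕ), ∀ a : α, P a →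
    ∃ (b : β) (s : State) (t : ℕ), R a b ∧ Exec prog (init (encIn a)) s t ∧
      s.output = encOut b ∧ t ≤ bound.eval (inputSize (encIn a))

end Ram

/-! ## Evacuation planning -/

namespace Evacuation

/-- The nodes of the road network: the disjoint union of `nE` evacuation nodes (areas),
`nT` transit nodes and `nS` safe nodes. -/
inductive Node (nE nT nS : ℕ) : Type
  | evac (k : Fin nE) : Node nE nT nS
  | transit (i : Fin nT) : Node nE nT nS
  | safe (i : Fin nS) : Node nE nT nS
  deriving DecidableEq

/-- The number of a node: evacuation nodes first, then transit nodes, then safe nodes. -/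
def Node.toNat {nE nT nS : ℕ} : Node nE nT nS → ℕ
  | .evac k => k
  | .transit i => nE + i
  | .safe i => nE + nT + i

/-- An instance: a directed graph with evacuation, transit and safe nodes, arc data, a number of
evacuees for every evacuation node, a scheduling horizon, and for every evacuation node one
evacuation path (the list of its arcs), which is a simple path from this node to a safe node. -/
structure Instance : Type where
  /-- number of evacuation nodes -/
  nE : ℕ
  /-- number of transit nodes -/
  nT : ℕ
  /-- number of safe nodes -/
  nS : ℕ
  /-- number of arcs -/
  nA : ℕ
  /-- tail of an arc -/
  tail : Fin nA → Node nE nT nS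
  /-- head of an arc -/
  head : Fin nA → Node nE nT nS
  /-- travel time of an arc -/
  travel : Fin nA → NNRat
  /-- capacity of an arc (vehicles per unit of time) -/
  cap : Fin nA → NNRat
  /-- time at which an arc becomes unavailable; `⊤` if this never happens -/
  close : Fin nA → WithTop NNRat
  /-- number of evacuees -/
  demand : Fin nE → ℕ
  /-- scheduling horizon -/
  horizon : ℕ
  /-- evacuation path, as a list of arcs -/
  path : Fin nE → List (Fin nA)
  path_ne_nil : ∀ k, path k ≠ []
  path_start : ∀ k, tail ((path k).head (path_ne_nil k)) = Node.evac k
  path_chain : ∀ k, (path k).IsChain fun e f => head e = tail f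
  path_simple : ∀ k, (Node.evac k :: (path k).map head).Nodup
  path_end : ∀ k, ∃ i, head ((path k).getLast (path_ne_nil k)) = Node.safe i

namespace Instance

/-- Travel time of an arc in the model: rounded up to the next integer. -/
def arcTime (I : Instance) (e : Fin I.nA) : ℕ := ⌈I.travel e⌉₊

/-- Travel time from the area `k` to the tail of an arc `e` of its path: the sum of the (rounded)
travel times of the arcs before `e`. -/
def timeToTail (I : Instance) (k : Fin I.nE) (e : Fin I.nA) : ℕ :=
  (((I.path k).takeWhile fun f => f ≠ e).map I.arcTime).sum

/-- Travel time from the area `k` to the head of an arc `e` of its path. -/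
def timeToHead (I : Instance) (k : Fin I.nE) (e : Fin I.nA) : ℕ :=
  I.timeToTail k e + I.arcTime e

/-- Total travel time of the path of `k`. -/
def pathTime (I : Instance) (k : Fin I.nE) : ℕ := ((I.path k).map I.arcTime).sum

/-- Path capacity: the minimum capacity of an arc of the path. -/
def pathCap (I : Instance) (k : Fin I.nE) : NNRat :=
  (I.path k).toFinset.inf' (List.toFinset_nonempty_iff _ |>.mpr (I.path_ne_nil k)) I.cap

/-- Last possible departure time: the minimum, over the arcs `e` of the path, of the time at
which `e` becomes unavailable minus the travel time to the head of `e`; `⊤` if no arc is cut. -/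
def lastDep (I : Instance) (k : Fin I.nE) : WithTop ℚ :=
  (I.path k).toFinset.inf fun e => (I.close e).map fun f : NNRat => (f : ℚ) - (I.timeToHead k e : ℚ)

/-- Upper bound of the domains of the start and of the end time of area `k`: the minimum of the
horizon minus the path travel time and of the last departure time rounded down. It may be
negative, in which case these domains are empty. -/
def latestEnd (I : Instance) (k : Fin I.nE) : ℤ :=
  min ((I.horizon : ℤ) - I.pathTime k)
    (((I.lastDep k).map Int.floor).untopD ((I.horizon : ℤ) - I.pathTime k))

/-- Latest completion time of the path of `k` at its safe node: the latest time at which the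
evacuation of `k` can end, shifted by the travel time to the safe node. -/
def latestCompletion (I : Instance) (k : Fin I.nE) : ℤ := I.latestEnd k + I.pathTime k

/-- The end of the path of `k`, which is a safe node. -/
def safeNode (I : Instance) (k : Fin I.nE) : Node I.nE I.nT I.nS :=
  I.head ((I.path k).getLast (I.path_ne_nil k))

/-- The evacuation paths are convergent, that is, without forks: together they form a forest of
trees rooted at safe nodes. No node is left by two different path arcs, and no safe node is left
by a path arc. -/
def Convergent (I : Instance) : Prop :=
  (∀ k l, ∀ e ∈ I.path k, ∀ f ∈ I.path l, I.tail e = I.tail f → e = f) ∧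
    ∀ k, ∀ e ∈ I.path k, ∀ i, I.tail e ≠ Node.safe i

/-- All evacuation paths to a safe node share the same latest completion time there. -/
def SameCompletion (I : Instance) : Prop :=
  ∀ k l, I.safeNode k = I.safeNode l → I.latestCompletion k = I.latestCompletion l

/-- The encoding of an instance as a list of natural numbers. Rational numbers are given by
numerator and denominator, the closing time `⊤` by the pair `0, 0`. -/
def encode (I : Instance) : List ℕ :=
  [I.nE, I.nT, I.nS, I.nA, I.horizon] ++
  (List.finRange I.nA).flatMap (fun e =>
    [(I.tail e).toNat, (I.head e).toNat, (I.travel e).num, (I.travel e).den,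
      (I.cap e).num, (I.cap e).den] ++
    WithTop.recTopCoe (C := fun _ => List ℕ) [0, 0] (fun f => [f.num, f.den]) (I.close e)) ++
  (List.finRange I.nE).flatMap fun k =>
    [I.demand k, (I.path k).length] ++ (I.path k).map fun e => (e : ℕ)

end Instance

/-- The decision variables of the scheduling models for `n` areas. -/
structure Schedule (n : ℕ) : Type where
  /-- number of vehicles evacuated -/
  flow : Fin n → ℕ
  /-- number of vehicles departing per unit of time -/
  rate : Fin n → ℕ
  /-- evacuation start time -/
  start : Fin n → ℕ
  /-- evacuation duration -/
  dur : Fin n → ℕ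
  /-- evacuation end time -/
  finish : Fin n → ℕ

/-- A solution of the constraints of the non-preemptive phased evacuation model. -/
structure Feasible (I : Instance) (S : Schedule I.nE) : Prop where
  /-- domain of the flow -/
  flow_le : ∀ k, S.flow k ≤ I.demand k
  /-- domain of the flow rate -/
  one_le_rate : ∀ k, 1 ≤ S.rate k
  rate_le : ∀ k, S.rate k ≤ min (I.demand k) ⌊I.pathCap k⌋₊
  /-- domain of the start time -/
  start_le : ∀ k, (S.start k : ℤ) ≤ I.latestEnd k
  /-- domain of the end time -/
  finish_le : ∀ k, (S.finish k : ℤ) ≤ I.latestEnd k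
  /-- domain of the duration -/
  dur_le : ∀ k, S.dur k ≤ I.demand k
  /-- start, duration and end form a task -/
  start_add_dur : ∀ k, S.start k + S.dur k = S.finish k
  /-- the flow is the minimum of duration times flow rate and of the demand -/
  flow_eq : ∀ k, S.flow k = min (S.dur k * S.rate k) (I.demand k)
  /-- the flow rate is set to its upper bound -/
  rate_eq : ∀ k, S.rate k = min (I.demand k) ⌊I.pathCap k⌋₊
  /-- on every arc, the tasks of the areas whose paths use it do not overlap -/
  disjunctive : ∀ e : Fin I.nA, ∀ k l : Fin I.nE, k ≠ l → e ∈ I.path k → e ∈ I.path l →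
    S.finish k + I.timeToTail k e ≤ S.start l + I.timeToTail l e ∨
      S.finish l + I.timeToTail l e ≤ S.start k + I.timeToTail k e

/-- The number of evacuated vehicles. -/
def Schedule.objective {n : ℕ} (S : Schedule n) : ℕ := ∑ k, S.flow k

/-- A feasible solution that evacuates the maximal number of vehicles. -/
def IsOptimal (I : Instance) (S : Schedule I.nE) : Prop :=
  Feasible I S ∧ ∀ S' : Schedule I.nE, Feasible I S' → S'.objective ≤ S.objective

/-- The answer to an instance: a schedule, or `none` for "infeasible". -/
def Answer : Type := Option (Σ n : ℕ, Schedule n)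

/-- `A` solves the maximum flow version of the non-preemptive phased evacuation model on `I`: it
is an optimal solution, or it reports "infeasible" and there is no feasible solution. -/
def Solves (I : Instance) (A : Answer) : Prop :=
  (∃ S : Schedule I.nE, A = some ⟨I.nE, S⟩ ∧ IsOptimal I S) ∨
    (A = none ∧ ∀ S : Schedule I.nE, ¬ Feasible I S)

/-- The encoding of an answer as a list of natural numbers. -/
def Answer.encode : Answer → List ℕ
  | none => [0]
  | some ⟨n, S⟩ => 1 :: (List.finRange n).flatMap fun k =>
      [S.flow k, S.rate k, S.start k, S.dur k, S.finish k]

end Evacuation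

/-! Convergence turns the arcwise disjunctions into independent single-machine problems. Two paths
with a common arc coincide from that arc on (`Instance.suffix_eq`), so they share the last arc, and
their travel times to each common arc differ by the same amount as their total travel times
(`Instance.Convergent.of_mem`). Hence non-overlap on all common arcs amounts to disjointness of the
intervals `[start + pathTime, finish + pathTime)` among the areas with the same last arc, and areas
with different last arcs never meet. Each last arc is a machine on which the task of `k` is released
at `pathTime k`, and all its tasks have one common deadline `C`.

With a common deadline, given durations can be scheduled if and only if, for every `k`, the tasks
released no earlier than that of `k` have total duration at most `C - pathTime k`. Disjoint
intervals in a window give necessity (`Instance.sum_dur_le`); packing the tasks backwards from the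
deadline, in the order of their releases, gives sufficiency (`IsItems.feasible`). On each machine
these constraints are nested.

The flow of an area with demand `d` and rate `r` is a concave function of its duration: slope `r`
for `d / r` time steps, then `d % r` for one more. Two items per area therefore make the objective
linear, and allocating the items greedily by decreasing weight is optimal (`Greedy.Inv.optimal`):
for every threshold, greedy maximizes the total allocation of the items above it, and the objective
is the sum of these totals over all thresholds. There are `2 * nE` items however large the numbers
are, so the running time is polynomial in the binary length.

The program uses only counted loops, and every product it forms is bounded by a number already at
hand. So each step lengthens the largest number by at most one bit, and polynomially many steps take
polynomial logarithmic cost (`solvableInPolyTime_of_wp`). Correctness is a weakest-precondition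
proof with loop invariants (`Cmd.wp_rep`). -/

/-! ## A structured language on top of the random access machine -/

namespace Ram

/-- Arithmetic expressions over variables and memory. The third argument of `mul` is an upper bound
of the product, see `Expr.Ok`. -/
inductive Expr : Type
  | var (v : ℕ) : Expr
  | lit (c : ℕ) : Expr
  | mem (a : Expr) : Expr
  | add (a b : Expr) : Expr
  | sub (a b : Expr) : Expr
  | div (a b : Expr) : Expr
  | mul (a b c : Expr) : Expr

namespace Expr

/-- The value of an expression. -/
def eval (s : State) : Expr → ℕ
  | var v => s.reg v
  | lit c => c
  | mem a => s.mem (a.eval s)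
  | add a b => a.eval s + b.eval s
  | sub a b => a.eval s - b.eval s
  | div a b => a.eval s / b.eval s
  | mul a b _ => a.eval s * b.eval s

/-- All products in the expression respect the bounds they are annotated with. -/
def Ok (s : State) : Expr → Prop
  | var _ => True
  | lit _ => True
  | mem a => a.Ok s
  | add a b => a.Ok s ∧ b.Ok s
  | sub a b => a.Ok s ∧ b.Ok s
  | div a b => a.Ok s ∧ b.Ok s
  | mul a b c => a.Ok s ∧ b.Ok s ∧ c.Ok s ∧ a.eval s * b.eval s ≤ c.eval s

/-- Code that evaluates an expression into the `t`-th temporary, that is, into register `2 * t + 1`.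
Variables live in the registers with even numbers. -/
def compile (t : ℕ) : Expr → Prog
  | var v => .seq (.const (2 * t + 1) 0) (.add (2 * t + 1) (2 * v) (2 * t + 1))
  | lit c => .const (2 * t + 1) c
  | mem a => .seq (a.compile t) (.load (2 * t + 1) (2 * t + 1))
  | add a b => .seq (.seq (a.compile t) (b.compile (t + 1)))
      (.add (2 * t + 1) (2 * t + 1) (2 * (t + 1) + 1))
  | sub a b => .seq (.seq (a.compile t) (b.compile (t + 1)))
      (.sub (2 * t + 1) (2 * t + 1) (2 * (t + 1) + 1))
  | div a b => .seq (.seq (a.compile t) (b.compile (t + 1)))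
      (.div (2 * t + 1) (2 * t + 1) (2 * (t + 1) + 1))
  | mul a b c => .seq (.seq (c.compile t) (.seq (a.compile (t + 1)) (b.compile (t + 2))))
      (.mul (2 * t + 1) (2 * (t + 1) + 1) (2 * (t + 2) + 1))

/-- A bound on the number of instructions of the code of an expression. -/
def cost : Expr → ℕ
  | var _ => 2
  | lit c => 1 + c.size
  | mem a => a.cost + 1
  | add a b => a.cost + b.cost + 1
  | sub a b => a.cost + b.cost + 1
  | div a b => a.cost + b.cost + 1
  | mul a b c => c.cost + (a.cost + b.cost) + 1

end Expr

/-! ### Step counts and the growth of bit lengths -/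

/-- All registers and memory cells hold numbers with at most `B` binary digits. -/
def State.Bounded (B : ℕ) (s : State) : Prop := (∀ r, s.reg r < 2 ^ B) ∧ ∀ a, s.mem a < 2 ^ B

/-- The program `p` takes `s` to `s'` in `n` steps, each of which increases the number of binary
digits of the largest number by at most one. -/
def Runs (p : Prog) (n : ℕ) (s s' : State) : Prop :=
  ∀ B, s.Bounded B → s'.Bounded (B + n) ∧ ∃ t, Exec p s s' t ∧ t ≤ n * (2 * (B + n) + 1)

theorem State.Bounded.mono {B B' : ℕ} {s : State} (h : s.Bounded B) (hB : B ≤ B') :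
    s.Bounded B' :=
  ⟨fun r => (h.1 r).trans_le (Nat.pow_le_pow_right two_pos hB),
    fun a => (h.2 a).trans_le (Nat.pow_le_pow_right two_pos hB)⟩

theorem State.Bounded.setReg {B : ℕ} {s : State} (h : s.Bounded B) (r : ℕ) {v : ℕ}
    (hv : v < 2 ^ B) : (s.setReg r v).Bounded B := by
  refine ⟨fun r' => ?_, h.2⟩
  rcases eq_or_ne r' r with rfl | hne
  · simpa [State.setReg] using hv
  · simpa [State.setReg, hne] using h.1 r'

theorem State.Bounded.setMem {B : ℕ} {s : State} (h : s.Bounded B) (a : ℕ) {v : ℕ}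
    (hv : v < 2 ^ B) : (s.setMem a v).Bounded B := by
  refine ⟨h.1, fun a' => ?_⟩
  rcases eq_or_ne a' a with rfl | hne
  · simpa [State.setMem] using hv
  · simpa [State.setMem, hne] using h.2 a'

namespace Runs

theorem mono {p : Prog} {n m : ℕ} {s s' : State} (h : Runs p n s s') (hnm : n ≤ m) :
    Runs p m s s' := fun B hB => by
  obtain ⟨hb, t, ht, hle⟩ := h B hB
  exact ⟨hb.mono (by omega), t, ht, hle.trans (Nat.mul_le_mul hnm (by omega))⟩

theorem seq {p q : Prog} {n m : ℕ} {s s' s'' : State} (h : Runs p n s s')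
    (h' : Runs q m s' s'') : Runs (.seq p q) (n + m) s s'' := fun B hB => by
  obtain ⟨hb, t, ht, hle⟩ := h B hB
  obtain ⟨hb', t', ht', hle'⟩ := h' _ hb
  refine ⟨hb'.mono (by omega), t + t', ht.seq ht', ?_⟩
  calc t + t' ≤ n * (2 * (B + (n + m)) + 1) + m * (2 * (B + (n + m)) + 1) :=
        add_le_add (hle.trans (Nat.mul_le_mul le_rfl (by omega)))
          (hle'.trans (Nat.mul_le_mul le_rfl (by omega)))
    _ = _ := by ring

/-- A single instruction or test handles at most two numbers of `B` bits; the summand `n` leaves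
room for the literal of `const`. -/
theorem of_bounded {p : Prog} {n : ℕ} {s s' : State} (hn : 1 ≤ n)
    (h : ∀ B, s.Bounded B → s'.Bounded (B + n) ∧ ∃ t, Exec p s s' t ∧ t ≤ 1 + n + 2 * B) :
    Runs p n s s' := fun B hB => by
  obtain ⟨hb, t, ht, hle⟩ := h B hB
  refine ⟨hb, t, ht, hle.trans ?_⟩
  nlinarith

theorem skip (s : State) : Runs .skip 1 s s :=
  of_bounded le_rfl fun _ hB => ⟨hB.mono (by omega), _, .skip s, by omega⟩

theorem const (s : State) (r c : ℕ) : Runs (.const r c) (1 + c.size) s (s.setReg r c) :=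
  of_bounded (by omega) fun B hB => ⟨(hB.mono (by omega)).setReg _
    ((Nat.lt_size_self c).trans_le (Nat.pow_le_pow_right two_pos (by omega))),
    _, .const s r c, by omega⟩

theorem add (s : State) (r a b : ℕ) :
    Runs (.add r a b) 1 s (s.setReg r (s.reg a + s.reg b)) :=
  of_bounded le_rfl fun B hB => by
    have ha := Nat.size_le.2 (hB.1 a)
    have hb := Nat.size_le.2 (hB.1 b)
    refine ⟨(hB.mono (by omega)).setReg _ ?_, _, .add s r a b, by omega⟩
    have := hB.1 a
    have := hB.1 b
    rw [pow_succ]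
    omega

theorem sub (s : State) (r a b : ℕ) :
    Runs (.sub r a b) 1 s (s.setReg r (s.reg a - s.reg b)) :=
  of_bounded le_rfl fun B hB => by
    have ha := Nat.size_le.2 (hB.1 a)
    have hb := Nat.size_le.2 (hB.1 b)
    exact ⟨(hB.setReg _ ((Nat.sub_le _ _).trans_lt (hB.1 a))).mono (by omega),
      _, .sub s r a b, by omega⟩

theorem div (s : State) (r a b : ℕ) :
    Runs (.div r a b) 1 s (s.setReg r (s.reg a / s.reg b)) :=
  of_bounded le_rfl fun B hB => by
    have ha := Nat.size_le.2 (hB.1 a)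
    have hb := Nat.size_le.2 (hB.1 b)
    exact ⟨(hB.setReg _ ((Nat.div_le_self _ _).trans_lt (hB.1 a))).mono (by omega),
      _, .div s r a b, by omega⟩

/-- The product is dominated by the content of another register, so nothing gets longer. Without
such a bound, repeated squaring would double the bit length in each step. -/
theorem mul (s : State) (r a b c : ℕ) (h : s.reg a * s.reg b ≤ s.reg c) :
    Runs (.mul r a b) 1 s (s.setReg r (s.reg a * s.reg b)) :=
  of_bounded le_rfl fun B hB => by
    have ha := Nat.size_le.2 (hB.1 a)
    have hb := Nat.size_le.2 (hB.1 b)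
    exact ⟨(hB.setReg _ (h.trans_lt (hB.1 c))).mono (by omega), _, .mul s r a b, by omega⟩

theorem load (s : State) (r a : ℕ) :
    Runs (.load r a) 1 s (s.setReg r (s.mem (s.reg a))) :=
  of_bounded le_rfl fun B hB => by
    have ha := Nat.size_le.2 (hB.1 a)
    have hb := Nat.size_le.2 (hB.2 (s.reg a))
    exact ⟨(hB.setReg _ (hB.2 _)).mono (by omega), _, .load s r a, by omega⟩

theorem store (s : State) (a b : ℕ) :
    Runs (.store a b) 1 s (s.setMem (s.reg a) (s.reg b)) :=
  of_bounded le_rfl fun B hB => by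
    have ha := Nat.size_le.2 (hB.1 a)
    have hb := Nat.size_le.2 (hB.1 b)
    exact ⟨(hB.setMem _ (hB.1 _)).mono (by omega), _, .store s a b, by omega⟩

theorem ite_true {r : ℕ} {p q : Prog} {n : ℕ} {s s' : State} (hr : s.reg r ≠ 0)
    (h : Runs p n s s') : Runs (.ite r p q) (n + 1) s s' := fun B hB => by
  obtain ⟨hb, t, ht, hle⟩ := h B hB
  have := Nat.size_le.2 (hB.1 r)
  exact ⟨hb.mono (by omega), _, .ite_true hr ht, by nlinarith⟩

theorem ite_false {r : ℕ} {p q : Prog} {n : ℕ} {s s' : State} (hr : s.reg r = 0)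
    (h : Runs q n s s') : Runs (.ite r p q) (n + 1) s s' := fun B hB => by
  obtain ⟨hb, t, ht, hle⟩ := h B hB
  have := Nat.size_le.2 (hB.1 r)
  exact ⟨hb.mono (by omega), _, .ite_false hr ht, by nlinarith⟩

theorem loop_done {r : ℕ} {p : Prog} {s : State} (hr : s.reg r = 0) :
    Runs (.loop r p) 1 s s :=
  of_bounded le_rfl fun B hB => by
    have := Nat.size_le.2 (hB.1 r)
    exact ⟨hB.mono (by omega), _, .loop_done hr, by omega⟩

theorem loop_step {r : ℕ} {p : Prog} {n m : ℕ} {s s' s'' : State} (hr : s.reg r ≠ 0)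
    (h : Runs p n s s') (h' : Runs (.loop r p) m s' s'') :
    Runs (.loop r p) (n + 1 + m) s s'' := fun B hB => by
  obtain ⟨hb, t, ht, hle⟩ := h B hB
  obtain ⟨hb', t', ht', hle'⟩ := h' _ hb
  have := Nat.size_le.2 (hB.1 r)
  refine ⟨hb'.mono (by omega), _, .loop_step hr ht ht', ?_⟩
  calc 1 + (s.reg r).size + t + t'
      ≤ 1 * (2 * (B + (n + 1 + m)) + 1) + n * (2 * (B + (n + 1 + m)) + 1)
        + m * (2 * (B + (n + 1 + m)) + 1) :=
        add_le_add (add_le_add (by omega) (hle.trans (Nat.mul_le_mul le_rfl (by omega))))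
          (hle'.trans (Nat.mul_le_mul le_rfl (by omega)))
    _ = _ := by ring

end Runs

/-! ### Simulation of expressions and commands by machine code -/

/-- The machine state `σ` represents the state `s` of the structured language. -/
def Sim (s σ : State) : Prop := σ.mem = s.mem ∧ ∀ v, σ.reg (2 * v) = s.reg v

theorem Sim.setTemp {s σ : State} (h : Sim s σ) (t v : ℕ) : Sim s (σ.setReg (2 * t + 1) v) := by
  refine ⟨h.1, fun w => ?_⟩
  have : 2 * w ≠ 2 * t + 1 := by omega
  simpa [State.setReg, this] using h.2 w

/-- The temporaries with number less than `t` are the same in both states. -/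
def SameBelow (t : ℕ) (σ σ' : State) : Prop := ∀ i < t, σ'.reg (2 * i + 1) = σ.reg (2 * i + 1)

theorem SameBelow.trans {t : ℕ} {σ σ' σ'' : State} (h : SameBelow t σ σ')
    (h' : SameBelow t σ' σ'') : SameBelow t σ σ'' := fun i hi => (h' i hi).trans (h i hi)

theorem SameBelow.mono {t t' : ℕ} {σ σ' : State} (h : SameBelow t' σ σ') (ht : t ≤ t') :
    SameBelow t σ σ' := fun i hi => h i (hi.trans_le ht)

theorem SameBelow.setTemp {t : ℕ} (σ : State) {t' : ℕ} (ht : t ≤ t') (v : ℕ) :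
    SameBelow t σ (σ.setReg (2 * t' + 1) v) := fun i hi => by
  have : i ≠ t' := by omega
  simp [State.setReg, this]

theorem Expr.runs (e : Expr) : ∀ (t : ℕ) (s σ : State), Sim s σ → e.Ok s →
    ∃ σ', Runs (e.compile t) e.cost σ σ' ∧ σ'.reg (2 * t + 1) = e.eval s ∧ Sim s σ' ∧
      SameBelow t σ σ' := by
  have binary : ∀ (a b : Expr) (op : ℕ → ℕ → ℕ) (ins : ℕ → ℕ → ℕ → Prog),
      (∀ (t : ℕ) (s σ : State), Sim s σ → a.Ok s → ∃ σ', Runs (a.compile t) a.cost σ σ' ∧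
        σ'.reg (2 * t + 1) = a.eval s ∧ Sim s σ' ∧ SameBelow t σ σ') →
      (∀ (t : ℕ) (s σ : State), Sim s σ → b.Ok s → ∃ σ', Runs (b.compile t) b.cost σ σ' ∧
        σ'.reg (2 * t + 1) = b.eval s ∧ Sim s σ' ∧ SameBelow t σ σ') →
      (∀ σ r x y, Runs (ins r x y) 1 σ (σ.setReg r (op (σ.reg x) (σ.reg y)))) →
      ∀ (t : ℕ) (s σ : State), Sim s σ → a.Ok s ∧ b.Ok s →
      ∃ σ', Runs (.seq (.seq (a.compile t) (b.compile (t + 1)))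
          (ins (2 * t + 1) (2 * t + 1) (2 * (t + 1) + 1))) (a.cost + b.cost + 1) σ σ' ∧
        σ'.reg (2 * t + 1) = op (a.eval s) (b.eval s) ∧ Sim s σ' ∧ SameBelow t σ σ' := by
    intro a b op ins iha ihb hins t s σ hs hok
    obtain ⟨σ₁, h₁, hv₁, hs₁, hb₁⟩ := iha t s σ hs hok.1
    obtain ⟨σ₂, h₂, hv₂, hs₂, hb₂⟩ := ihb (t + 1) s σ₁ hs₁ hok.2
    refine ⟨_, (h₁.seq h₂).seq (hins σ₂ _ _ _), ?_, hs₂.setTemp _ _,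
      (hb₁.trans (hb₂.mono (by omega))).trans (.setTemp _ le_rfl _)⟩
    simp [State.setReg, hv₂, hb₂ t (by omega), hv₁]
  induction e with
  | var v =>
    intro t s σ hs _
    refine ⟨_, (Runs.const _ _ _).seq (Runs.add _ _ _ _), ?_, (hs.setTemp _ _).setTemp _ _,
      (SameBelow.setTemp _ le_rfl _).trans (.setTemp _ le_rfl _)⟩
    have : 2 * v ≠ 2 * t + 1 := by omega
    simp [State.setReg, this, hs.2, eval]
  | lit c =>
    intro t s σ hs _
    exact ⟨_, Runs.const _ _ _, by simp [State.setReg, eval], hs.setTemp _ _,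
      .setTemp _ le_rfl _⟩
  | mem a ih =>
    intro t s σ hs hok
    obtain ⟨σ₁, h₁, hv, hs₁, hb⟩ := ih t s σ hs hok
    exact ⟨_, h₁.seq (Runs.load _ _ _), by simp [State.setReg, eval, hv, hs₁.1],
      hs₁.setTemp _ _, hb.trans (.setTemp _ le_rfl _)⟩
  | add a b iha ihb => exact binary a b (· + ·) .add iha ihb Runs.add
  | sub a b iha ihb => exact binary a b (· - ·) .sub iha ihb Runs.sub
  | div a b iha ihb => exact binary a b (· / ·) .div iha ihb Runs.div
  | mul a b c iha ihb ihc =>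
    intro t s σ hs hok
    obtain ⟨ha, hb, hc, hle⟩ := hok
    obtain ⟨σ₁, h₁, hv₁, hs₁, hb₁⟩ := ihc t s σ hs hc
    obtain ⟨σ₂, h₂, hv₂, hs₂, hb₂⟩ := iha (t + 1) s σ₁ hs₁ ha
    obtain ⟨σ₃, h₃, hv₃, hs₃, hb₃⟩ := ihb (t + 2) s σ₂ hs₂ hb
    have e₁ : σ₃.reg (2 * t + 1) = c.eval s := by
      rw [hb₃ t (by omega), hb₂ t (by omega), hv₁]
    have e₂ : σ₃.reg (2 * (t + 1) + 1) = a.eval s := by rw [hb₃ (t + 1) (by omega), hv₂]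
    refine ⟨_, (h₁.seq (h₂.seq h₃)).seq (Runs.mul σ₃ _ _ _ (2 * t + 1) ?_), ?_,
      hs₃.setTemp _ _, ((hb₁.trans (hb₂.mono (by omega))).trans (hb₃.mono (by omega))).trans
        (.setTemp _ le_rfl _)⟩
    · rw [e₁, e₂, hv₃]
      exact hle
    · simp only [State.setReg, Function.update_self, eval]
      rw [e₂, hv₃]

/-- Commands of the structured language. `rep e p` evaluates `e` once and then repeats `p` that
many times. -/
inductive Cmd : Type
  | skip : Cmd
  | set (v : ℕ) (e : Expr) : Cmd
  | store (a e : Expr) : Cmd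
  | seq (p q : Cmd) : Cmd
  | ite (e : Expr) (p q : Cmd) : Cmd
  | rep (e : Expr) (p : Cmd) : Cmd

namespace Cmd

/-- The machine code of a command, which leaves the temporaries with number less than `t` alone. -/
def compile (t : ℕ) : Cmd → Prog
  | skip => .skip
  | set v e => .seq (e.compile t)
      (.seq (.const (2 * (t + 1) + 1) 0) (.add (2 * v) (2 * t + 1) (2 * (t + 1) + 1)))
  | store a e => .seq (.seq (a.compile t) (e.compile (t + 1)))
      (.store (2 * t + 1) (2 * (t + 1) + 1))
  | seq p q => .seq (p.compile t) (q.compile t)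
  | ite e p q => .seq (e.compile t) (.ite (2 * t + 1) (p.compile t) (q.compile t))
  | rep e p => .seq (e.compile t) (.loop (2 * t + 1) (.seq (p.compile (t + 1))
      (.seq (.const (2 * (t + 1) + 1) 1) (.sub (2 * t + 1) (2 * t + 1) (2 * (t + 1) + 1)))))

/-- A bound on the number of steps of a command all of whose repetitions are at most `K`-fold. -/
def cost (K : ℕ) : Cmd → ℕ
  | skip => 1
  | set _ e => e.cost + 2
  | store a e => a.cost + e.cost + 1
  | seq p q => p.cost K + q.cost K
  | ite e p q => e.cost + (p.cost K + q.cost K + 1)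
  | rep e p => e.cost + (K * (p.cost K + 4) + 1)

/-- Weakest precondition: started in `s`, the command makes `Q` true, and all its repetitions are
at most `K`-fold. -/
def wp (K : ℕ) : Cmd → (State → Prop) → State → Prop
  | skip, Q, s => Q s
  | set v e, Q, s => e.Ok s ∧ Q (s.setReg v (e.eval s))
  | store a e, Q, s => (a.Ok s ∧ e.Ok s) ∧ Q (s.setMem (a.eval s) (e.eval s))
  | seq p q, Q, s => p.wp K (q.wp K Q) s
  | ite e p q, Q, s => e.Ok s ∧ (e.eval s ≠ 0 → p.wp K Q s) ∧ (e.eval s = 0 → q.wp K Q s)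
  | rep e p, Q, s => e.Ok s ∧ e.eval s ≤ K ∧ (p.wp K)^[e.eval s] Q s

theorem wp_mono {K : ℕ} (c : Cmd) : ∀ {Q Q' : State → Prop}, (∀ s, Q s → Q' s) →
    ∀ {s : State}, c.wp K Q s → c.wp K Q' s := by
  induction c with
  | skip => exact fun h _ hs => h _ hs
  | set v e => exact fun h _ hs => ⟨hs.1, h _ hs.2⟩
  | store a e => exact fun h _ hs => ⟨hs.1, h _ hs.2⟩
  | seq p q ihp ihq => exact fun h _ hs => ihp (fun _ => ihq h) hs
  | ite e p q ihp ihq =>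
    exact fun h _ hs => ⟨hs.1, fun he => ihp h (hs.2.1 he), fun he => ihq h (hs.2.2 he)⟩
  | rep e p ih =>
    intro Q Q' h s hs
    refine ⟨hs.1, hs.2.1, ?_⟩
    have key : ∀ n s, (p.wp K)^[n] Q s → (p.wp K)^[n] Q' s := by
      intro n
      induction n with
      | zero => exact h
      | succ n ihn =>
        intro s
        rw [Function.iterate_succ_apply', Function.iterate_succ_apply']
        exact ih ihn
    exact key _ _ hs.2.2

/-- Repetition with an invariant that depends on the number of rounds already made. -/
theorem wp_rep {K : ℕ} {e : Expr} {p : Cmd} {Q : State → Prop} {s : State}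
    (Inv : ℕ → State → Prop) (n : ℕ) (hok : e.Ok s) (hn : e.eval s = n) (hK : n ≤ K)
    (h0 : Inv 0 s) (hstep : ∀ i < n, ∀ s, Inv i s → p.wp K (Inv (i + 1)) s)
    (hQ : ∀ s, Inv n s → Q s) : (rep e p).wp K Q s := by
  refine ⟨hok, hn ▸ hK, ?_⟩
  rw [hn]
  have key : ∀ j ≤ n, ∀ s, Inv (n - j) s → (p.wp K)^[j] Q s := by
    intro j
    induction j with
    | zero => exact fun _ s hs => hQ s hs
    | succ j ih =>
      intro hj s hs
      rw [Function.iterate_succ_apply']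
      refine p.wp_mono (fun s' hs' => ih (by omega) s' ?_) (hstep (n - (j + 1)) (by omega) s hs)
      rwa [show n - (j + 1) + 1 = n - j by omega] at hs'
  exact key n le_rfl s (by simpa using h0)

/-- Induction on the command. The counter of a repetition is temporary `t`, while the body is
compiled with `t + 1`, so `SameBelow` protects the counter. Temporaries and variables cannot
collide, by parity of the register number. -/
theorem runs {K : ℕ} (c : Cmd) : ∀ (t : ℕ) (s σ : State) (Q : State → Prop), Sim s σ →
    c.wp K Q s → ∃ s' σ', Runs (c.compile t) (c.cost K) σ σ' ∧ Sim s' σ' ∧ Q s' ∧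
      SameBelow t σ σ' := by
  induction c with
  | skip => exact fun t s σ Q hs hQ => ⟨s, σ, Runs.skip σ, hs, hQ, fun _ _ => rfl⟩
  | set v e =>
    intro t s σ Q hs ⟨hok, hQ⟩
    obtain ⟨σ₁, h₁, hv, hs₁, hb⟩ := e.runs t s σ hs hok
    refine ⟨_, _, (h₁.seq (((Runs.const _ _ _).seq (Runs.add _ _ _ _)))).mono ?_, ?_, hQ,
      (hb.trans (.setTemp _ (Nat.le_succ t) 0)).trans ?_⟩
    · simp [cost]
    · refine ⟨hs₁.1, fun w => ?_⟩
      simp only [State.setReg, Function.update_apply]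
      split_ifs with h1 h2 h3 <;> first | omega | simp [hs₁.2]
    · intro i _
      have : 2 * i + 1 ≠ 2 * v := by omega
      simp [State.setReg, this]
  | store a e =>
    intro t s σ Q hs ⟨⟨hoka, hoke⟩, hQ⟩
    obtain ⟨σ₁, h₁, hv₁, hs₁, hb₁⟩ := a.runs t s σ hs hoka
    obtain ⟨σ₂, h₂, hv₂, hs₂, hb₂⟩ := e.runs (t + 1) s σ₁ hs₁ hoke
    refine ⟨_, _, (h₁.seq h₂).seq (Runs.store _ _ _), ?_, hQ, hb₁.trans (hb₂.mono (by omega))⟩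
    rw [hv₂, hb₂ t (by omega), hv₁]
    exact ⟨by simp [State.setMem, hs₂.1], hs₂.2⟩
  | seq p q ihp ihq =>
    intro t s σ Q hs hQ
    obtain ⟨s₁, σ₁, h₁, hs₁, hQ₁, hb₁⟩ := ihp t s σ _ hs hQ
    obtain ⟨s₂, σ₂, h₂, hs₂, hQ₂, hb₂⟩ := ihq t s₁ σ₁ Q hs₁ hQ₁
    exact ⟨s₂, σ₂, h₁.seq h₂, hs₂, hQ₂, hb₁.trans hb₂⟩
  | ite e p q ihp ihq =>
    intro t s σ Q hs ⟨hok, hp, hq⟩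
    obtain ⟨σ₁, h₁, hv, hs₁, hb⟩ := e.runs t s σ hs hok
    by_cases he : e.eval s = 0
    · obtain ⟨s₂, σ₂, h₂, hs₂, hQ₂, hb₂⟩ := ihq t s σ₁ Q hs₁ (hq he)
      exact ⟨s₂, σ₂, h₁.seq ((Runs.ite_false (hv.trans he) h₂).mono (by omega)), hs₂, hQ₂,
        hb.trans hb₂⟩
    · obtain ⟨s₂, σ₂, h₂, hs₂, hQ₂, hb₂⟩ := ihp t s σ₁ Q hs₁ (hp he)
      exact ⟨s₂, σ₂, h₁.seq ((Runs.ite_true (hv ▸ he) h₂).mono (by omega)), hs₂, hQ₂,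
        hb.trans hb₂⟩
  | rep e p ih =>
    intro t s σ Q hs ⟨hok, hK, hQ⟩
    obtain ⟨σ₁, h₁, hv, hs₁, hb⟩ := e.runs t s σ hs hok
    have key : ∀ n (s σ : State), Sim s σ → σ.reg (2 * t + 1) = n → (p.wp K)^[n] Q s →
        ∃ s' σ', Runs (.loop (2 * t + 1) (.seq (p.compile (t + 1))
          (.seq (.const (2 * (t + 1) + 1) 1) (.sub (2 * t + 1) (2 * t + 1) (2 * (t + 1) + 1)))))
          (n * (p.cost K + 4) + 1) σ σ' ∧ Sim s' σ' ∧ Q s' ∧ SameBelow t σ σ' := by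
      intro n
      induction n with
      | zero =>
        intro s σ hs hn hQ
        exact ⟨s, σ, (Runs.loop_done hn).mono (by omega), hs, hQ, fun _ _ => rfl⟩
      | succ n ihn =>
        intro s σ hs hn hQ
        rw [Function.iterate_succ_apply'] at hQ
        obtain ⟨s₂, σ₂, h₂, hs₂, hQ₂, hb₂⟩ := ih (t + 1) s σ _ hs hQ
        -- The overhead of 4 per round in `cost`: two for the literal 1, one for the subtraction,
        -- one for the test.
        have hstep := h₂.seq ((Runs.const σ₂ (2 * (t + 1) + 1) 1).seq
          (Runs.sub _ (2 * t + 1) (2 * t + 1) (2 * (t + 1) + 1)))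
        obtain ⟨s₃, σ₃, h₃, hs₃, hQ₃, hb₃⟩ := ihn _
          (((σ₂.setReg (2 * (t + 1) + 1) 1).setReg (2 * t + 1) _))
          ((hs₂.setTemp (t + 1) 1).setTemp t
            ((σ₂.setReg (2 * (t + 1) + 1) 1).reg (2 * t + 1) -
              (σ₂.setReg (2 * (t + 1) + 1) 1).reg (2 * (t + 1) + 1)))
          (by simp [State.setReg, hb₂ t (by omega), hn]) hQ₂
        refine ⟨s₃, σ₃, (Runs.loop_step (by omega) hstep h₃).mono ?_, hs₃, hQ₃, ?_⟩
        · simp only [Nat.size_one]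
          linarith
        · exact ((hb₂.mono (by omega)).trans
            ((SameBelow.setTemp _ (Nat.le_succ t) _).trans (.setTemp _ le_rfl _))).trans hb₃
    obtain ⟨s₂, σ₂, h₂, hs₂, hQ₂, hb₂⟩ := key _ s σ₁ hs₁ hv hQ
    exact ⟨s₂, σ₂, h₁.seq (h₂.mono (by gcongr)), hs₂, hQ₂, hb.trans hb₂⟩

/-- The nesting depth of the loops is fixed with the command, so the loop bound enters polynomially.
The bound is `2 * N` because the greedy loop makes two rounds per area. -/
theorem exists_polynomial_cost (c : Cmd) :
    ∃ P : Polynomial ℕ, ∀ N, P.eval N = c.cost (2 * N) := by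
  induction c with
  | skip => exact ⟨1, fun N => by simp [cost]⟩
  | set v e => exact ⟨(e.cost + 2 : ℕ), fun N => by simp [cost, -Nat.cast_add]⟩
  | store a e => exact ⟨(a.cost + e.cost + 1 : ℕ), fun N => by simp [cost, -Nat.cast_add]⟩
  | seq p q ihp ihq =>
    obtain ⟨P, hP⟩ := ihp
    obtain ⟨P', hP'⟩ := ihq
    exact ⟨P + P', fun N => by simp [cost, hP, hP']⟩
  | ite e p q ihp ihq =>
    obtain ⟨P, hP⟩ := ihp
    obtain ⟨P', hP'⟩ := ihq
    exact ⟨((e.cost : ℕ) : Polynomial ℕ) + (P + P' + 1), fun N => by simp [cost, hP, hP']⟩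
  | rep e p ih =>
    obtain ⟨P, hP⟩ := ih
    exact ⟨((e.cost : ℕ) : Polynomial ℕ) + (2 * Polynomial.X * (P + 4) + 1), fun N => by simp [cost, hP]⟩

end Cmd

/-! ### From commands to polynomial time -/

theorem length_le_inputSize (x : List ℕ) : x.length ≤ inputSize x := by
  induction x with
  | nil => simp
  | cons a x ih =>
    simp only [inputSize, List.map_cons, List.sum_cons, List.length_cons] at ih ⊢
    omega

theorem size_le_inputSize {x : List ℕ} {a : ℕ} (ha : a ∈ x) : a.size ≤ inputSize x := by
  have := List.single_le_sum (l := x.map fun n => n.size + 1) (by simp) _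
    (List.mem_map_of_mem (f := fun n => n.size + 1) ha)
  simp only [inputSize]
  omega

theorem bounded_init (x : List ℕ) : (init x).Bounded (inputSize x) := by
  have h0 : 0 < 2 ^ inputSize x := by positivity
  refine ⟨fun r => ?_, fun a => ?_⟩
  · simp only [init]
    split_ifs
    · exact (length_le_inputSize x).trans_lt Nat.lt_two_pow_self
    · exact h0
  · simp only [init]
    by_cases ha : a < x.length
    · rw [List.getD_eq_getElem _ _ ha]
      exact Nat.size_le.1 (size_le_inputSize (List.getElem_mem ha))
    · rwa [List.getD_eq_default _ _ (by omega)]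

/-- A problem is solvable in polynomial time if it is solved by a command whose repetitions are
bounded linearly in the size of the input. -/
theorem solvableInPolyTime_of_wp {α β : Type} {encIn : α → List ℕ} {encOut : β → List ℕ}
    {P : α → Prop} {R : α → β → Prop} (c : Cmd)
    (h : ∀ a, P a → c.wp (2 * inputSize (encIn a))
      (fun s => ∃ b, R a b ∧ s.output = encOut b) (init (encIn a))) :
    SolvableInPolyTime encIn encOut P R := by
  obtain ⟨C, hC⟩ := c.exists_polynomial_cost
  -- This is the time bound of `Runs` for `C(N)` steps from numbers of `N` bits.
  refine ⟨c.compile 0, C * (2 * (Polynomial.X + C) + 1), fun a ha => ?_⟩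
  -- Doubling fixes register 0, and all other registers start at zero, so the initial state
  -- represents itself.
  have hsim : Sim (init (encIn a)) (init (encIn a)) := ⟨rfl, fun v => by simp [init]⟩
  obtain ⟨s', σ', hrun, hs', ⟨b, hR, hout⟩, -⟩ := c.runs 0 _ _ _ hsim (h a ha)
  obtain ⟨-, t, ht, hle⟩ := hrun _ (bounded_init _)
  refine ⟨b, σ', t, hR, ht, ?_, ?_⟩
  · rw [← hout]
    have h0 := hs'.2 0
    simp only [mul_zero] at h0
    simp [State.output, hs'.1, h0]
  · simpa [hC] using hle

end Ram

/-! ## Greedy allocation under nested constraints -/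

namespace Greedy

open Finset

/-- The state of the greedy algorithm for maximizing `∑ w i * x i` subject to `x i ≤ m i` and the
constraints `∑ x i ≤ cap j`, where the sum is over all `i` with `rel j i`. The items in `done` have
been allocated, and `R` are the residual capacities. -/
structure Inv (M : ℕ) (w m cap : ℕ → ℕ) (rel : ℕ → ℕ → Prop) [DecidableRel rel]
    (done : Finset ℕ) (x R : ℕ → ℕ) : Prop where
  subset : done ⊆ range M
  le : ∀ i, x i ≤ m i
  zero : ∀ i ∉ done, x i = 0
  residual : ∀ j < M, R j + ∑ i ∈ range M with rel j i, x i = cap j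
  sorted : ∀ i ∈ done, ∀ i' < M, i' ∉ done → w i' ≤ w i
  saturated : ∀ i ∈ done, x i = m i ∨
    ∃ j < M, rel j i ∧ R j = 0 ∧ ∀ i' < M, rel j i' → x i' ≠ 0 → w i ≤ w i'

variable {M : ℕ} {w m cap : ℕ → ℕ} {rel : ℕ → ℕ → Prop} [DecidableRel rel]

theorem Inv.start : Inv M w m cap rel ∅ (fun _ => 0) cap :=
  ⟨by simp, by simp, by simp, by simp, by simp, by simp⟩

/-- Allocating as much as possible of an item of maximal weight preserves the invariant. -/
theorem Inv.step {done : Finset ℕ} {x R : ℕ → ℕ} (h : Inv M w m cap rel done x R) {b v : ℕ}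
    (hb : b < M) (hbd : b ∉ done) (hmax : ∀ i < M, i ∉ done → w i ≤ w b) (hvm : v ≤ m b)
    (hvR : ∀ j < M, rel j b → v ≤ R j) (hv : v = m b ∨ ∃ j < M, rel j b ∧ v = R j) :
    Inv M w m cap rel (insert b done) (Function.update x b v)
      (fun j => if rel j b then R j - v else R j) where
  subset := insert_subset (mem_range.2 hb) h.subset
  le i := by
    rcases eq_or_ne i b with rfl | hne
    · simpa using hvm
    · simpa [hne] using h.le i
  zero i hi := by
    rw [mem_insert, not_or] at hi
    simpa [hi.1] using h.zero i hi.2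
  residual j hj := by
    have hx := h.zero b hbd
    have hres := h.residual j hj
    by_cases hjb : rel j b
    · have hmem : b ∈ {i ∈ range M | rel j i} := by simp [hb, hjb]
      rw [sum_update_of_mem hmem, ← hres, ← add_sum_erase _ _ hmem, hx, sdiff_singleton_eq_erase]
      have := hvR j hj hjb
      simp only [hjb, if_true]
      omega
    · have hmem : b ∉ {i ∈ range M | rel j i} := by simp [hjb]
      rw [sum_update_of_notMem hmem, ← hres]
      simp [hjb]
  sorted i hi i' hi' hi'd := by
    rw [mem_insert, not_or] at hi'd
    rcases mem_insert.1 hi with rfl | hi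
    · exact hmax i' hi' hi'd.2
    · exact h.sorted i hi i' hi' hi'd.2
  saturated i hi := by
    rcases mem_insert.1 hi with rfl | hid
    · rcases hv with hv | ⟨j, hj, hji, hv⟩
      · exact .inl (by simpa using hv)
      -- The constraint `j` has just become tight. Any other item with a nonzero allocation was done
      -- before, hence is at least as heavy by `sorted`.
      · refine .inr ⟨j, hj, hji, by simp [hji, hv], fun i' hi' _ hx => ?_⟩
        rcases eq_or_ne i' i with rfl | hne
        · exact le_rfl
        · by_contra hlt
          have hi'd : i' ∈ done := by
            by_contra hnd
            exact hx (by simpa [hne] using h.zero i' hnd)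
          exact hlt (h.sorted i' hi'd i hb hbd)
    · have hne : i ≠ b := fun e => hbd (e ▸ hid)
      rcases h.saturated i hid with hm | ⟨j, hj, hji, hR, hall⟩
      · exact .inl (by simpa [hne] using hm)
      · refine .inr ⟨j, hj, hji, by simp [hR], fun i' hi' hji' hx => ?_⟩
        rcases eq_or_ne i' b with rfl | hne'
        -- Nothing enters a constraint that is already tight, since `v ≤ R j = 0`.
        · have := hvR j hj hji'
          simp only [Function.update_self] at hx
          omega
        · exact hall i' hi' hji' (by simpa [hne'] using hx)

/-- When every item has been allocated, the allocation is optimal, provided that the constraints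
are given by the final segments of a linear order within each of several classes. -/
theorem Inv.optimal {α : Type*} [LinearOrder α] {key : ℕ → α} {cls : ℕ → ℕ}
    (hrel : ∀ j i, rel j i ↔ cls j = cls i ∧ key j ≤ key i) {x R : ℕ → ℕ}
    (h : Inv M w m cap rel (range M) x R) {y : ℕ → ℕ} (hym : ∀ i < M, y i ≤ m i)
    (hy : ∀ j < M, ∑ i ∈ range M with rel j i, y i ≤ cap j) :
    ∑ i ∈ range M, w i * y i ≤ ∑ i ∈ range M, w i * x i := by
  -- The heart of the argument: greedy is optimal for all thresholds at once, and classes can be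
  -- compared separately.
  have level : ∀ θ, ∑ i ∈ range M with θ ≤ w i, y i ≤ ∑ i ∈ range M with θ ≤ w i, x i := by
    intro θ
    set S := {i ∈ range M | θ ≤ w i} with hS
    rw [← sum_fiberwise_of_maps_to (s := S) (t := S.image cls) (g := cls)
        (fun i hi => mem_image_of_mem _ hi) x,
      ← sum_fiberwise_of_maps_to (s := S) (t := S.image cls) (g := cls)
        (fun i hi => mem_image_of_mem _ hi) y]
    refine sum_le_sum fun c _ => ?_
    set J := {j ∈ range M | cls j = c ∧ R j = 0 ∧
      ∀ i' < M, rel j i' → x i' ≠ 0 → θ ≤ w i'} with hJ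
    -- A tight constraint that stopped an item of weight at least `θ` contains no allocated item
    -- below `θ`, so it lies in `J`.
    have full : ∀ i ∈ S, cls i = c → (∀ j ∈ J, ¬ rel j i) → x i = m i := by
      intro i hi hc hno
      simp only [hS, mem_filter, mem_range] at hi
      rcases h.saturated i (mem_range.2 hi.1) with hm | ⟨j, hj, hji, hR, hall⟩
      · exact hm
      · refine absurd hji (hno j ?_)
        simp only [hJ, mem_filter, mem_range]
        exact ⟨hj, ((hrel j i).1 hji).1.trans hc, hR,
          fun i' hi' hr hx => hi.2.trans (hall i' hi' hr hx)⟩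
    rcases J.eq_empty_or_nonempty with hJe | hJn
    · refine sum_le_sum fun i hi => ?_
      rw [mem_filter] at hi
      rw [full i hi.1 hi.2 (by simp [hJe])]
      exact hym i (by simpa [hS] using (mem_filter.1 hi.1).1)
    -- The constraints of a class are nested, so the one of least key contains all others in `J`.
    -- Inside it, tightness gives `x` the full capacity, and none of it is spent below `θ`; outside
    -- it, `x` is at its upper bounds.
    · obtain ⟨j, hj, hmin⟩ := exists_min_image J key hJn
      have hj' := hj
      simp only [hJ, mem_filter, mem_range] at hj'
      obtain ⟨hjM, hjc, hjR, hjall⟩ := hj'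
      rw [← sum_filter_add_sum_filter_not _ (rel j) y,
        ← sum_filter_add_sum_filter_not _ (rel j) x]
      refine add_le_add ?_ (sum_le_sum fun i hi => ?_)
      · have hx : ∑ i ∈ {i ∈ S | cls i = c} with rel j i, x i =
            ∑ i ∈ range M with rel j i, x i := by
          refine sum_subset (fun i hi => ?_) fun i hi hni => ?_
          · simp only [hS, mem_filter] at hi ⊢
            exact ⟨hi.1.1.1, hi.2⟩
          · by_contra hx
            simp only [hS, mem_filter, mem_range] at hi hni
            exact hni ⟨⟨⟨hi.1, hjall i hi.1 hi.2 hx⟩, (((hrel j i).1 hi.2).1.symm.trans hjc)⟩, hi.2⟩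
        have hres := h.residual j hjM
        rw [hjR, zero_add] at hres
        rw [hx, hres]
        refine (sum_le_sum_of_subset fun i hi => ?_).trans (hy j hjM)
        simp only [hS, mem_filter] at hi ⊢
        exact ⟨hi.1.1.1, hi.2⟩
      · simp only [mem_filter] at hi
        obtain ⟨⟨hiS, hic⟩, hji⟩ := hi
        rw [full i hiS hic fun j' hj' hr => hji ?_]
        · exact hym i (by simpa [hS] using (mem_filter.1 hiS).1)
        · exact (hrel j i).2 ⟨hjc.trans hic.symm, (hmin j' hj').trans ((hrel j' i).1 hr).2⟩
  set W := (range M).sup w with hW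
  -- Layer-cake formula: `w i` counts the thresholds `1 ≤ θ ≤ w i`.
  have layer : ∀ z : ℕ → ℕ, ∑ i ∈ range M, w i * z i =
      ∑ θ ∈ Icc 1 W, ∑ i ∈ range M with θ ≤ w i, z i := by
    intro z
    simp_rw [sum_filter]
    rw [sum_comm]
    refine sum_congr rfl fun i hi => ?_
    have hwi : w i ≤ W := le_sup hi
    rw [← sum_filter, sum_const, smul_eq_mul]
    congr 1
    have : {θ ∈ Icc 1 W | θ ≤ w i} = Icc 1 (w i) := by
      ext θ
      simp only [mem_filter, mem_Icc]
      omega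
    simp [this]
  rw [layer, layer]
  exact sum_le_sum fun θ _ => level θ

end Greedy

/-! ## Evacuation along convergent paths -/

namespace Evacuation

namespace Instance

variable (I : Instance)

theorem nodup_path (k : Fin I.nE) : (I.path k).Nodup :=
  List.Nodup.of_map _ (List.nodup_cons.1 (I.path_simple k)).2

theorem timeToTail_of_append {k : Fin I.nE} {p s : List (Fin I.nA)} {e : Fin I.nA}
    (h : I.path k = p ++ e :: s) : I.timeToTail k e = (p.map I.arcTime).sum := by
  have hnd := I.nodup_path k
  rw [h, List.nodup_append] at hnd
  have hp : ∀ f ∈ p, f ≠ e := fun f hf => hnd.2.2 f hf e (by simp)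
  rw [timeToTail, h, List.takeWhile_append_of_pos (by simpa using hp)]
  simp

/-- Two convergent paths agree after a common arc. -/
theorem suffix_eq (hc : I.Convergent) {k l : Fin I.nE} : ∀ (s s' p p' : List (Fin I.nA))
    (e : Fin I.nA), I.path k = p ++ e :: s → I.path l = p' ++ e :: s' → s = s' := by
  have head_eq : ∀ {k : Fin I.nE} {p s : List (Fin I.nA)} {e f : Fin I.nA},
      I.path k = p ++ e :: f :: s → I.head e = I.tail f := by
    intro k p s e f h
    have := I.path_chain k
    rw [h, List.isChain_append] at this
    exact (List.isChain_cons_cons.1 this.2.1).1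
  -- If one path ends with `e`, then the head of `e` is a safe node, which no path arc leaves.
  have no_exit : ∀ {k l : Fin I.nE} {p p' s : List (Fin I.nA)} {e f : Fin I.nA},
      I.path k = p ++ [e] → I.path l = p' ++ e :: f :: s → False := by
    intro k l p p' s e f h h'
    obtain ⟨i, hi⟩ := I.path_end k
    have hl : (I.path k).getLast (I.path_ne_nil k) = e := by simp [h]
    rw [hl, head_eq h'] at hi
    exact hc.2 l f (by simp [h']) i hi
  intro s
  induction s with
  | nil =>
    intro s' p p' e h h'
    cases s' with
    | nil => rfl
    | cons f s' => exact (no_exit h h').elim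
  | cons f s ih =>
    intro s' p p' e h h'
    cases s' with
    | nil => exact (no_exit h' h).elim
    | cons g s' =>
      obtain rfl : f = g := hc.1 k l f (by simp [h]) g (by simp [h'])
        ((head_eq h).symm.trans (head_eq h'))
      rw [ih s' (p ++ [e]) (p' ++ [e]) f (by simp [h]) (by simp [h'])]

/-- The last arc of an evacuation path. -/
def lastArc (k : Fin I.nE) : Fin I.nA := (I.path k).getLast (I.path_ne_nil k)

theorem lastArc_mem (k : Fin I.nE) : I.lastArc k ∈ I.path k := List.getLast_mem _

variable {I}

/-- Two convergent paths with a common arc have the same last arc, and the two travel times from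
the tail of the common arc to the end agree. -/
theorem Convergent.of_mem (hc : I.Convergent) {k l : Fin I.nE} {e : Fin I.nA}
    (hk : e ∈ I.path k) (hl : e ∈ I.path l) : I.lastArc k = I.lastArc l ∧
      I.timeToTail k e + I.pathTime l = I.timeToTail l e + I.pathTime k := by
  obtain ⟨p, s, h⟩ := List.append_of_mem hk
  obtain ⟨p', s', h'⟩ := List.append_of_mem hl
  obtain rfl := I.suffix_eq hc s s' p p' e h h'
  constructor
  · simp [lastArc, h, h']
  · rw [I.timeToTail_of_append h, I.timeToTail_of_append h', pathTime, pathTime, h, h']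
    simp only [List.map_append, List.sum_append]
    omega

variable (I)

/-- The latest time to leave the head of an arc, if the latest time to leave its tail is `C`. -/
def cutoff (C : ℕ) (e : Fin I.nA) : ℕ :=
  WithTop.recTopCoe (C := fun _ => ℕ) (C + I.arcTime e)
    (fun f => min (C + I.arcTime e) (f.num / f.den)) (I.close e)

/-- The latest completion time of a path, computed along the path. -/
def completion (k : Fin I.nE) : ℕ := min ((I.path k).foldl I.cutoff I.horizon) I.horizon

/-- The flow rate of an area, computed along its path. -/
def maxRate (k : Fin I.nE) : ℕ :=
  (I.path k).foldl (fun c e => min c ((I.cap e).num / (I.cap e).den)) (I.demand k)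

end Instance

/-! ### Rational data in integer arithmetic -/

theorem le_num_div_den_iff (z : ℕ) (q : NNRat) : z ≤ q.num / q.den ↔ (z : NNRat) ≤ q := by
  rw [Nat.le_div_iff_mul_le q.den_pos]
  conv_rhs => rw [← NNRat.num_div_den q, le_div_iff₀ (by exact_mod_cast q.den_pos)]
  exact_mod_cast Iff.rfl

theorem add_natCast_le_num_div_den_iff (z : ℤ) (n : ℕ) (q : NNRat) :
    z + n ≤ (q.num / q.den : ℕ) ↔ (z : ℚ) + n ≤ q := by
  rcases le_or_gt 0 (z + n) with h0 | h0
  · lift z + n to ℕ using h0 with y hy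
    have hq : (z : ℚ) + n = y := by exact_mod_cast hy.symm
    rw [hq, Nat.cast_le, le_num_div_den_iff]
    exact_mod_cast Iff.rfl
  · refine iff_of_true (h0.le.trans (Int.natCast_nonneg _)) ?_
    have : (z : ℚ) + n < 0 := by exact_mod_cast h0
    exact this.le.trans (by positivity)

theorem natCeil_nnrat (q : NNRat) : ⌈q⌉₊ = (q.num + q.den - 1) / q.den := by
  have hd := q.den_pos
  refine eq_of_forall_ge_iff fun z => ?_
  rw [Nat.ceil_le, ← Nat.lt_succ_iff, Nat.div_lt_iff_lt_mul hd]
  conv_lhs => rw [← NNRat.num_div_den q, div_le_iff₀ (by exact_mod_cast hd)]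
  have : ((q.num : NNRat) ≤ z * q.den) ↔ q.num ≤ z * q.den := by exact_mod_cast Iff.rfl
  rw [this, Nat.succ_mul]
  omega

namespace Instance

variable (I : Instance)

/-- Rounding the closing times down arc by arc loses nothing, because departure times and rounded
travel times are integers. The initial value contributes only `z ≤ I.horizon`, which is weaker than
the horizon bound at the safe node that `completion` adds. -/
theorem foldl_cutoff (k : Fin I.nE) (z : ℤ) (p : List (Fin I.nA)) : ∀ s, I.path k = p ++ s →
    (z + (p.map I.arcTime).sum ≤ (p.foldl I.cutoff I.horizon : ℕ) ↔
      z ≤ I.horizon ∧ ∀ e ∈ p, ∀ f : NNRat, I.close e = f → (z : ℚ) + I.timeToHead k e ≤ f) := by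
  induction p using List.reverseRecOn with
  | nil => simp
  | append_singleton p e ih =>
    intro s h
    have h' : I.path k = p ++ e :: s := by simpa using h
    have ih := ih _ h'
    have hT := I.timeToTail_of_append h'
    have hH : I.timeToHead k e = (p.map I.arcTime).sum + I.arcTime e := by
      rw [timeToHead, hT]
    simp only [List.map_append, List.sum_append, List.map_cons, List.map_nil, List.sum_cons,
      List.sum_nil, List.foldl_append, List.foldl_cons, List.foldl_nil, List.mem_append,
      List.mem_singleton, or_imp, forall_and, forall_eq, ← and_assoc, ← ih, hH]
    cases hf : I.close e with
    | top =>
      simp only [cutoff, hf, WithTop.recTopCoe_top]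
      have : ∀ f : NNRat, ¬ (⊤ : WithTop NNRat) = (f : WithTop NNRat) := fun f => by simp
      simp only [this, false_imp_iff, implies_true, and_true]
      push_cast
      omega
    | coe f =>
      simp only [cutoff, hf, WithTop.recTopCoe_coe, WithTop.coe_inj, forall_eq']
      rw [← add_natCast_le_num_div_den_iff]
      push_cast
      omega

theorem le_latestEnd_iff (k : Fin I.nE) (z : ℤ) : z ≤ I.latestEnd k ↔
    z + I.pathTime k ≤ I.horizon ∧
      ∀ e ∈ I.path k, ∀ f : NNRat, I.close e = f → (z : ℚ) + I.timeToHead k e ≤ f := by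
  have h₁ : ((z : ℚ) : WithTop ℚ) ≤ I.lastDep k ↔
      ∀ e ∈ I.path k, ∀ f : NNRat, I.close e = f → (z : ℚ) + I.timeToHead k e ≤ f := by
    rw [lastDep, Finset.le_inf_iff]
    simp only [List.mem_toFinset]
    refine forall₂_congr fun e _ => ?_
    cases hf : I.close e with
    | top => simp
    | coe f =>
      simp only [WithTop.map_coe, WithTop.coe_le_coe, WithTop.coe_inj, forall_eq']
      exact le_sub_iff_add_le
  rw [← h₁, latestEnd, le_min_iff]
  cases hd : I.lastDep k with
  | top => simp; omega
  | coe q =>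
    simp only [WithTop.map_coe, WithTop.untopD_coe, WithTop.coe_le_coe, Int.le_floor]
    refine and_congr_left fun _ => ?_
    omega

/-- Both sides bound the same integers. In particular the latest completion time is never negative,
although `latestEnd` may be, so computing it in `ℕ` is safe. -/
theorem latestCompletion_eq (k : Fin I.nE) : I.latestCompletion k = I.completion k := by
  have h : I.latestEnd k = (I.completion k : ℤ) - I.pathTime k := by
    refine eq_of_forall_le_iff fun z => ?_
    have := I.foldl_cutoff k z (I.path k) [] (by simp)
    rw [le_latestEnd_iff, completion, le_sub_iff_add_le, Nat.cast_min, le_min_iff, pathTime, this]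
    refine ⟨fun h => ⟨⟨?_, h.2⟩, h.1⟩, fun h => ⟨h.2, h.1.2⟩⟩
    have := h.1
    omega
  rw [latestCompletion, h]
  omega

theorem maxRate_eq (k : Fin I.nE) : I.maxRate k = min (I.demand k) ⌊I.pathCap k⌋₊ := by
  refine eq_of_forall_le_iff fun z => ?_
  have key : ∀ (p : List (Fin I.nA)) (c : ℕ),
      z ≤ p.foldl (fun c e => min c ((I.cap e).num / (I.cap e).den)) c ↔
        z ≤ c ∧ ∀ e ∈ p, (z : NNRat) ≤ I.cap e := by
    intro p
    induction p with
    | nil => simp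
    | cons e p ih =>
      intro c
      rw [List.foldl_cons, ih, le_min_iff, le_num_div_den_iff, List.forall_mem_cons, and_assoc]
  rw [maxRate, key, le_min_iff, Nat.le_floor_iff zero_le, pathCap, Finset.le_inf'_iff]
  simp

variable {I}

theorem completion_eq_of_lastArc_eq (hs : I.SameCompletion) {k l : Fin I.nE}
    (h : I.lastArc k = I.lastArc l) : I.completion k = I.completion l := by
  have := hs k l (by
    change I.head (I.lastArc k) = I.head (I.lastArc l)
    rw [h])
  rw [latestCompletion_eq, latestCompletion_eq] at this
  exact_mod_cast this

/-- In a feasible schedule, the total duration of the tasks that end on the same arc and have a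
travel time of at least that of `k` is at most the time between their release and completion. -/
theorem sum_dur_le (hc : I.Convergent) (hs : I.SameCompletion) {S : Schedule I.nE}
    (hS : Feasible I S) (k : Fin I.nE) :
    ∑ l with I.lastArc k = I.lastArc l ∧ I.pathTime k ≤ I.pathTime l, S.dur l ≤
      I.completion k - I.pathTime k := by
  set A : Finset (Fin I.nE) := {l | I.lastArc k = I.lastArc l ∧ I.pathTime k ≤ I.pathTime l}
    with hA
  have hcard : ∀ l, S.dur l =
      (Finset.Ico (S.start l + I.pathTime l) (S.finish l + I.pathTime l)).card := by
    intro l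
    have := hS.start_add_dur l
    rw [Nat.card_Ico]
    omega
  -- Shifted to the safe node, the tasks are disjoint sets of time steps in the window from the
  -- travel time of `k` to the common completion time.
  rw [Finset.sum_congr rfl fun l _ => hcard l, ← Finset.card_biUnion, ← Nat.card_Ico]
  · refine Finset.card_le_card fun t ht => ?_
    simp only [hA, Finset.mem_biUnion, Finset.mem_filter, Finset.mem_univ, true_and,
      Finset.mem_Ico] at ht ⊢
    obtain ⟨l, ⟨hl, hT⟩, h₁, h₂⟩ := ht
    have h₃ := hS.finish_le l
    have h₄ := I.latestCompletion_eq l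
    have h₅ := completion_eq_of_lastArc_eq hs hl
    rw [latestCompletion] at h₄
    omega
  · intro l hl l' hl' hne
    simp only [hA, Finset.coe_filter, Finset.mem_univ, true_and, Set.mem_ofPred_eq] at hl hl'
    have e := I.lastArc_mem l
    have e' := I.lastArc_mem l'
    rw [← hl'.1, hl.1] at e'
    have h := hS.disjunctive _ l l' hne e e'
    -- Converts the times to the tail of the last arc into path times.
    have ht := (hc.of_mem e e').2
    refine Finset.disjoint_left.2 fun t ht₁ ht₂ => ?_
    rw [Finset.mem_Ico] at ht₁ ht₂
    omega

end Instance

/-! ### Scheduling as an allocation problem with nested constraints -/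

/-- The relation between constraints and items that is used by the greedy algorithm: item `i`
occupies the last arc `L i`, which it reaches after time `T i`. -/
def Rel (T L : ℕ → ℕ) (j i : ℕ) : Prop := L j = L i ∧ (T j < T i ∨ T j = T i ∧ j ≤ i)

instance (T L : ℕ → ℕ) : DecidableRel (Rel T L) := fun _ _ => by unfold Rel; infer_instance

/-- Every area gives rise to two items, the second of which stands for the last time step of the
evacuation, in which less than the full rate may be used. -/
structure IsItems (I : Instance) (w m T L cap : ℕ → ℕ) : Prop where
  w_even : ∀ k : Fin I.nE, w (2 * k) = I.maxRate k
  m_even : ∀ k : Fin I.nE, m (2 * k) = I.demand k / I.maxRate k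
  w_odd : ∀ k : Fin I.nE, w (2 * k + 1) = I.demand k % I.maxRate k
  m_odd : ∀ k : Fin I.nE, m (2 * k + 1) = min 1 (I.demand k % I.maxRate k)
  T_even : ∀ k : Fin I.nE, T (2 * k) = I.pathTime k
  T_odd : ∀ k : Fin I.nE, T (2 * k + 1) = I.pathTime k
  L_even : ∀ k : Fin I.nE, L (2 * k) = I.lastArc k
  L_odd : ∀ k : Fin I.nE, L (2 * k + 1) = I.lastArc k
  cap_even : ∀ k : Fin I.nE, cap (2 * k) = I.completion k - I.pathTime k
  cap_odd : ∀ k : Fin I.nE, cap (2 * k + 1) = I.completion k - I.pathTime k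

/-- The schedule that belongs to an allocation `x` with residual capacities `R`. -/
def scheduleOf (I : Instance) (x R : ℕ → ℕ) : Schedule I.nE where
  flow k := min ((x (2 * k) + x (2 * k + 1)) * I.maxRate k) (I.demand k)
  rate := I.maxRate
  start k := R (2 * k)
  dur k := x (2 * k) + x (2 * k + 1)
  finish k := R (2 * k) + (x (2 * k) + x (2 * k + 1))

theorem sum_range_two_mul (f : ℕ → ℕ) (n : ℕ) :
    ∑ i ∈ Finset.range (2 * n), f i = ∑ k : Fin n, (f (2 * k) + f (2 * k + 1)) := by
  rw [← Finset.sum_range fun k => f (2 * k) + f (2 * k + 1)]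
  induction n with
  | zero => simp
  | succ n ih =>
    rw [Finset.sum_range_succ, ← ih, Nat.mul_succ, Finset.sum_range_succ, Finset.sum_range_succ,
      add_assoc]

/-- The instance passes the test for feasibility. -/
def Admissible (I : Instance) : Prop := ∀ k, 1 ≤ I.maxRate k ∧ I.pathTime k ≤ I.completion k

/-- The only obstructions to feasibility are empty domains: under the hypotheses of the theorem,
`IsItems.feasible` provides the converse. -/
theorem Feasible.admissible {I : Instance} {S : Schedule I.nE} (hS : Feasible I S) :
    Admissible I := fun k => by
  have h₁ := hS.one_le_rate k
  have h₂ := hS.rate_eq k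
  have h₃ := hS.start_le k
  have h₄ := I.latestCompletion_eq k
  rw [← I.maxRate_eq] at h₂
  rw [Instance.latestCompletion] at h₄
  constructor <;> omega

variable {I : Instance} {w m T L cap x R : ℕ → ℕ}

theorem IsItems.dur_le (h : IsItems I w m T L cap) (hadm : Admissible I)
    (hx : ∀ i, x i ≤ m i) (k : Fin I.nE) : x (2 * k) + x (2 * k + 1) ≤ I.demand k := by
  have h₁ := hx (2 * k)
  have h₂ := hx (2 * k + 1)
  rw [h.m_even] at h₁
  rw [h.m_odd] at h₂
  have h₃ := Nat.div_add_mod (I.demand k) (I.maxRate k)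
  have h₄ := Nat.le_mul_of_pos_left (I.demand k / I.maxRate k) (hadm k).1
  omega

/-- The residual equation at `2 * k` says that `R (2 * k) + pathTime k` is the common completion
time minus the total duration of `k` and of its successors in the order of (travel time, index). So
the residual capacities are the start times of the backward packing without gaps. -/
theorem IsItems.feasible (h : IsItems I w m T L cap) (hc : I.Convergent) (hs : I.SameCompletion)
    (hadm : Admissible I)
    (hx : Greedy.Inv (2 * I.nE) w m cap (Rel T L) (Finset.range (2 * I.nE)) x R) :
    Feasible I (scheduleOf I x R) := by
  have res : ∀ k : Fin I.nE, R (2 * k) + ∑ l : Fin I.nE, (if I.lastArc k = I.lastArc l ∧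
      (I.pathTime k < I.pathTime l ∨ I.pathTime k = I.pathTime l ∧ k ≤ l)
        then x (2 * l) + x (2 * l + 1) else 0) = I.completion k - I.pathTime k := by
    intro k
    rw [← h.cap_even, ← hx.residual (2 * k) (by omega), Finset.sum_filter, sum_range_two_mul]
    congr 1
    refine Finset.sum_congr rfl fun l _ => ?_
    simp only [Rel, h.L_even, h.L_odd, h.T_even, h.T_odd, Fin.val_inj, Fin.le_def]
    have e₁ : (2 * (k : ℕ) ≤ 2 * l) ↔ (k : ℕ) ≤ l := by omega
    have e₂ : (2 * (k : ℕ) ≤ 2 * l + 1) ↔ (k : ℕ) ≤ l := by omega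
    simp only [e₁, e₂]
    split_ifs <;> rfl
  have seq : ∀ k l : Fin I.nE, k ≠ l → I.lastArc k = I.lastArc l →
      (I.pathTime k < I.pathTime l ∨ I.pathTime k = I.pathTime l ∧ k ≤ l) →
      R (2 * k) + (x (2 * k) + x (2 * k + 1)) + I.pathTime k ≤ R (2 * l) + I.pathTime l := by
    intro k l hne hL hT
    have hk := res k
    have hl := res l
    have hC := Instance.completion_eq_of_lastArc_eq hs hL
    have hak := (hadm k).2
    have hal := (hadm l).2
    -- The final segment of `l` does not contain `k`, and both lie in the final segment of `k`. The
    -- claim is then the difference of the two residual equations.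
    have hsum : (∑ a : Fin I.nE, if I.lastArc l = I.lastArc a ∧
        (I.pathTime l < I.pathTime a ∨ I.pathTime l = I.pathTime a ∧ l ≤ a)
          then x (2 * a) + x (2 * a + 1) else 0) +
        (∑ a : Fin I.nE, if k = a then x (2 * a) + x (2 * a + 1) else 0) ≤
        ∑ a : Fin I.nE, if I.lastArc k = I.lastArc a ∧
        (I.pathTime k < I.pathTime a ∨ I.pathTime k = I.pathTime a ∧ k ≤ a)
          then x (2 * a) + x (2 * a + 1) else 0 := by
      rw [← Finset.sum_add_distrib]
      refine Finset.sum_le_sum fun a _ => ?_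
      by_cases hka : k = a
      · subst hka
        have : ¬ (I.lastArc l = I.lastArc k ∧
            (I.pathTime l < I.pathTime k ∨ I.pathTime l = I.pathTime k ∧ l ≤ k)) := by
          simp only [Fin.le_def, ne_eq, Fin.ext_iff] at hne hT ⊢
          omega
        simp [this]
      · simp only [hka, if_false, add_zero]
        by_cases hla : I.lastArc l = I.lastArc a ∧
            (I.pathTime l < I.pathTime a ∨ I.pathTime l = I.pathTime a ∧ l ≤ a)
        · have hka' : I.pathTime k < I.pathTime a ∨ I.pathTime k = I.pathTime a ∧ k ≤ a := by
            simp only [Fin.le_def] at hT hla ⊢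
            omega
          rw [if_pos hla, if_pos ⟨hL.trans hla.1, hka'⟩]
        · simp [hla]
    rw [Finset.sum_ite_eq] at hsum
    simp only [Finset.mem_univ, if_true] at hsum
    omega
  have fin_le : ∀ k : Fin I.nE,
      ((R (2 * k) + (x (2 * k) + x (2 * k + 1)) : ℕ) : ℤ) ≤ I.latestEnd k := by
    intro k
    have h₁ := res k
    have h₂ := (hadm k).2
    have h₃ := I.latestCompletion_eq k
    rw [Instance.latestCompletion] at h₃
    have h₄ := Finset.single_le_sum (f := fun l : Fin I.nE => if I.lastArc k = I.lastArc l ∧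
      (I.pathTime k < I.pathTime l ∨ I.pathTime k = I.pathTime l ∧ k ≤ l)
        then x (2 * l) + x (2 * l + 1) else 0) (fun _ _ => Nat.zero_le _) (Finset.mem_univ k)
    simp only [le_refl, and_self, or_true, if_true] at h₄
    omega
  exact
    { flow_le := fun k => min_le_right _ _
      one_le_rate := fun k => (hadm k).1
      rate_le := fun k => (I.maxRate_eq k).le
      start_le := fun k => le_trans (by simp [scheduleOf]; omega) (fin_le k)
      finish_le := fin_le
      dur_le := h.dur_le hadm hx.le
      start_add_dur := fun k => rfl
      flow_eq := fun k => rfl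
      rate_eq := I.maxRate_eq
      disjunctive := fun e k l hne hk hl => by
        obtain ⟨hL, ht⟩ := hc.of_mem hk hl
        simp only [scheduleOf]
        rcases lt_trichotomy (I.pathTime k) (I.pathTime l) with hT | hT | hT
        · have := seq k l hne hL (.inl hT)
          omega
        · rcases le_total k l with hkl | hkl
          · have := seq k l hne hL (.inr ⟨hT, hkl⟩)
            omega
          · have := seq l k hne.symm hL.symm (.inr ⟨hT.symm, hkl⟩)
            omega
        · have := seq l k hne.symm hL.symm (.inl hT)
          omega }

/-- Any feasible flow is at most the value of an admissible allocation, and the greedy value is at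
most the flow of the greedy schedule. It need not be known that greedy fills the even item of an
area before the odd one. -/
theorem IsItems.isOptimal (h : IsItems I w m T L cap) (hc : I.Convergent)
    (hs : I.SameCompletion) (hadm : Admissible I)
    (hx : Greedy.Inv (2 * I.nE) w m cap (Rel T L) (Finset.range (2 * I.nE)) x R) :
    IsOptimal I (scheduleOf I x R) := by
  refine ⟨h.feasible hc hs hadm hx, fun S hS => ?_⟩
  -- The duration is spread over the two items, the even one first; time beyond both bounds
  -- evacuates nobody and is dropped.
  set y : ℕ → ℕ := fun i => if hi : i / 2 < I.nE then
    (if i % 2 = 0 then min (S.dur ⟨i / 2, hi⟩) (m i)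
      else min (S.dur ⟨i / 2, hi⟩ - min (S.dur ⟨i / 2, hi⟩) (m (i - 1))) (m i)) else 0 with hy
  have y_even : ∀ k : Fin I.nE, y (2 * k) = min (S.dur k) (m (2 * k)) := by
    intro k
    simp [hy]
  have y_odd : ∀ k : Fin I.nE,
      y (2 * k + 1) = min (S.dur k - min (S.dur k) (m (2 * k))) (m (2 * k + 1)) := by
    intro k
    have e₁ : (2 * (k : ℕ) + 1) / 2 = k := by omega
    have e₂ : (2 * (k : ℕ) + 1) % 2 = 1 := by omega
    simp [hy, e₁, e₂]
  have hrel : ∀ j i, Rel T L j i ↔ L j = L i ∧ toLex (T j, j) ≤ toLex (T i, i) := by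
    intro j i
    rw [Prod.Lex.toLex_le_toLex]
    rfl
  -- Breaking ties by index only removes items from the sum in `sum_dur_le`, so even and odd
  -- constraints are covered alike.
  have bound : ∀ (k : Fin I.nE) (j : ℕ), L j = I.lastArc k → T j = I.pathTime k →
      ∑ i ∈ Finset.range (2 * I.nE) with Rel T L j i, y i ≤
        I.completion k - I.pathTime k := by
    intro k j hL hT
    refine le_trans ?_ (Instance.sum_dur_le hc hs hS k)
    rw [Finset.sum_filter, Finset.sum_filter, sum_range_two_mul]
    refine Finset.sum_le_sum fun l _ => ?_
    simp only [Rel, hL, hT, h.L_even, h.L_odd, h.T_even, h.T_odd, Fin.val_inj, y_even, y_odd]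
    split_ifs <;> omega
  have hopt := hx.optimal (key := fun i => toLex (T i, i)) hrel (y := y) ?_ ?_
  · rw [sum_range_two_mul, sum_range_two_mul] at hopt
    refine (Finset.sum_le_sum fun k _ => ?_).trans
      (hopt.trans (Finset.sum_le_sum fun k _ => ?_))
    · rw [hS.flow_eq, hS.rate_eq, ← I.maxRate_eq, y_even, y_odd, h.w_even, h.w_odd, h.m_even,
        h.m_odd]
      have hdm := Nat.div_add_mod (I.demand k) (I.maxRate k)
      set q := I.demand k / I.maxRate k
      set r := I.demand k % I.maxRate k
      rcases le_or_gt (S.dur k) q with hle | hlt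
      · rw [min_eq_left hle, mul_comm]
        exact (min_le_left _ _).trans (Nat.le_add_right _ _)
      · rw [min_eq_right hlt.le]
        refine (min_le_right _ _).trans ?_
        rw [← hdm]
        refine Nat.add_le_add_left ?_ _
        rcases Nat.eq_zero_or_pos r with hr | hr
        · simp [hr]
        · rw [min_eq_left (show 1 ≤ r from hr), min_eq_right (by omega), mul_one]
    · simp only [scheduleOf, h.w_even, h.w_odd]
      -- The odd item weighs less than the full rate, so its time step is worth no more than one at
      -- full rate.
      have hr := Nat.mod_lt (I.demand k) (hadm k).1
      have hdm := Nat.div_add_mod (I.demand k) (I.maxRate k)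
      have h₁ := hx.le (2 * k)
      have h₂ := hx.le (2 * k + 1)
      rw [h.m_even] at h₁
      rw [h.m_odd] at h₂
      refine le_min ?_ ?_
      · nlinarith
      · rw [← hdm]
        refine add_le_add (Nat.mul_le_mul_left _ h₁) ?_
        simpa using Nat.mul_le_mul_left (I.demand k % I.maxRate k) (h₂.trans (min_le_left _ _))
  · intro i hi
    simp only [hy]
    split_ifs <;> simp
  · intro j hj
    obtain ⟨k, hk | hk⟩ : ∃ k : Fin I.nE, j = 2 * k ∨ j = 2 * k + 1 :=
      ⟨⟨j / 2, by omega⟩, by simp only; omega⟩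
    · rw [hk, h.cap_even]
      exact bound k _ (h.L_even k) (h.T_even k)
    · rw [hk, h.cap_odd]
      exact bound k _ (h.L_odd k) (h.T_odd k)

end Evacuation

/-! ## Programming in the structured language -/

namespace Ram

/-- The list `l` is stored in memory from address `a` on. -/
def SegAt (mem : ℕ → ℕ) (a : ℕ) (l : List ℕ) : Prop := ∀ i (h : i < l.length), mem (a + i) = l[i]

theorem SegAt.congr {mem mem' : ℕ → ℕ} {a : ℕ} {l : List ℕ} (h : SegAt mem a l)
    (hm : ∀ b, a ≤ b → b < a + l.length → mem' b = mem b) : SegAt mem' a l := fun i hi => by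
  rw [hm _ (by omega) (by omega), h i hi]

theorem segAt_append {mem : ℕ → ℕ} {a : ℕ} {l l' : List ℕ} :
    SegAt mem a (l ++ l') ↔ SegAt mem a l ∧ SegAt mem (a + l.length) l' := by
  constructor
  · refine fun h => ⟨fun i hi => ?_, fun i hi => ?_⟩
    · rw [h i (by simp; omega), List.getElem_append_left hi]
    · rw [add_assoc, h (l.length + i) (by simp; omega), List.getElem_append_right (by omega)]
      simp
  · rintro ⟨h, h'⟩ i hi
    rcases lt_or_ge i l.length with hlt | hge
    · rw [List.getElem_append_left hlt, h i hlt]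
    · rw [List.length_append] at hi
      rw [List.getElem_append_right hge, ← h' (i - l.length) (by omega)]
      congr 1
      omega

theorem segAt_cons {mem : ℕ → ℕ} {a x : ℕ} {l : List ℕ} :
    SegAt mem a (x :: l) ↔ mem a = x ∧ SegAt mem (a + 1) l := by
  rw [← List.singleton_append, segAt_append]
  refine and_congr ⟨fun h => h 0 (by simp), fun h i hi => ?_⟩ Iff.rfl
  obtain rfl : i = 0 := by simpa using hi
  simpa using h

theorem take_finRange_succ {n : ℕ} (k : Fin n) :
    (List.finRange n).take (k + 1) = (List.finRange n).take k ++ [k] := by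
  rw [List.take_succ_eq_append_getElem (by simp)]
  simp

/-- A concatenation of blocks is stored in memory if and only if every block is. -/
theorem segAt_flatMap_iff {mem : ℕ → ℕ} {a n : ℕ} {g : Fin n → List ℕ} :
    SegAt mem a ((List.finRange n).flatMap g) ↔
      ∀ k : Fin n, SegAt mem (a + (((List.finRange n).take k).flatMap g).length) (g k) := by
  have key : ∀ i ≤ n, (SegAt mem a (((List.finRange n).take i).flatMap g) ↔ ∀ k : Fin n, k < i →
      SegAt mem (a + (((List.finRange n).take k).flatMap g).length) (g k)) := by
    intro i
    induction i with
    | zero => exact fun _ => by simp [SegAt]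
    | succ i ih =>
      intro hi
      have ht := take_finRange_succ (⟨i, hi⟩ : Fin n)
      simp only at ht
      rw [ht, List.flatMap_append, segAt_append, ih (by omega)]
      simp only [List.flatMap_singleton]
      constructor
      · rintro ⟨h, h'⟩ k hk
        rcases Nat.lt_succ_iff_lt_or_eq.1 hk with hlt | heq
        · exact h k hlt
        · obtain rfl : k = ⟨i, hi⟩ := Fin.ext heq
          exact h'
      · exact fun h => ⟨fun k hk => h k (by omega), h ⟨i, hi⟩ (by simp)⟩
  have h := key n le_rfl
  rw [List.take_of_length_le (by simp)] at h
  rw [h]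
  exact ⟨fun h k => h k k.2, fun h k _ => h k⟩

theorem length_flatMap_take_finRange {n c : ℕ} {g : Fin n → List ℕ} (hg : ∀ k, (g k).length = c)
    {i : ℕ} (hi : i ≤ n) : (((List.finRange n).take i).flatMap g).length = c * i := by
  rw [List.length_flatMap, List.map_congr_left fun k _ => hg k]
  simp [hi, mul_comm]

theorem State.output_eq {s : State} {l : List ℕ} (h : SegAt s.mem 0 l) (h0 : s.reg 0 = l.length) :
    s.output = l := by
  refine List.ext_getElem (by simp [State.output, h0]) fun i hi hi' => ?_
  have := h i hi'
  simpa [State.output] using this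

theorem segAt_init (x : List ℕ) : SegAt (init x).mem 0 x := fun i hi => by
  simp [init, hi]

/-! ### Derived expressions and truth values -/

namespace Expr

instance : Add Expr := ⟨add⟩
instance : Sub Expr := ⟨sub⟩
instance : Div Expr := ⟨div⟩

variable (s : State) (a b : Expr)

@[simp] theorem eval_var (v : ℕ) : (var v).eval s = s.reg v := rfl
@[simp] theorem eval_lit (c : ℕ) : (lit c).eval s = c := rfl
@[simp] theorem eval_mem : (mem a).eval s = s.mem (a.eval s) := rfl
@[simp] theorem eval_add : (a + b).eval s = a.eval s + b.eval s := rfl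
@[simp] theorem eval_sub : (a - b).eval s = a.eval s - b.eval s := rfl
@[simp] theorem eval_div : (a / b).eval s = a.eval s / b.eval s := rfl
@[simp] theorem eval_mul (c : Expr) : (mul a b c).eval s = a.eval s * b.eval s := rfl
@[simp] theorem ok_var (v : ℕ) : (var v).Ok s := trivial
@[simp] theorem ok_lit (c : ℕ) : (lit c).Ok s := trivial
@[simp] theorem ok_mem : (mem a).Ok s ↔ a.Ok s := Iff.rfl
@[simp] theorem ok_add : (a + b).Ok s ↔ a.Ok s ∧ b.Ok s := Iff.rfl
@[simp] theorem ok_sub : (a - b).Ok s ↔ a.Ok s ∧ b.Ok s := Iff.rfl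
@[simp] theorem ok_div : (a / b).Ok s ↔ a.Ok s ∧ b.Ok s := Iff.rfl
@[simp] theorem ok_mul (c : Expr) : (mul a b c).Ok s ↔
    a.Ok s ∧ b.Ok s ∧ c.Ok s ∧ a.eval s * b.eval s ≤ c.eval s := Iff.rfl

/-- Eight times a number. -/
def times8 (a : Expr) : Expr := (a + a + (a + a)) + (a + a + (a + a))

/-- The minimum of two numbers. -/
def min (a b : Expr) : Expr := a - (a - b)

/-- Negation of truth values, where nonzero numbers count as true. -/
def not (a : Expr) : Expr := lit 1 - a

/-- Conjunction of truth values. -/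
def and (a b : Expr) : Expr := not (not a + not b)

/-- Disjunction of truth values. -/
def or (a b : Expr) : Expr := a + b

/-- Truth value of `a < b`. -/
def lt (a b : Expr) : Expr := b - a

/-- Truth value of `a ≤ b`. -/
def le (a b : Expr) : Expr := not (a - b)

/-- Truth value of `a = b`. -/
def eq (a b : Expr) : Expr := not ((a - b) + (b - a))

@[simp] theorem ok_times8 : (times8 a).Ok s ↔ a.Ok s := by simp [times8]
@[simp] theorem ok_min : (min a b).Ok s ↔ a.Ok s ∧ b.Ok s := by simp [min]
@[simp] theorem ok_not : (not a).Ok s ↔ a.Ok s := by simp [not]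
@[simp] theorem ok_and : (and a b).Ok s ↔ a.Ok s ∧ b.Ok s := by simp [and]
@[simp] theorem ok_or : (or a b).Ok s ↔ a.Ok s ∧ b.Ok s := by simp [or]
@[simp] theorem ok_lt : (lt a b).Ok s ↔ a.Ok s ∧ b.Ok s := by simp [lt, and_comm]
@[simp] theorem ok_le : (le a b).Ok s ↔ a.Ok s ∧ b.Ok s := by simp [le]
@[simp] theorem ok_eq : (eq a b).Ok s ↔ a.Ok s ∧ b.Ok s := by simp [eq]; tauto

@[simp] theorem eval_times8 : (times8 a).eval s = 8 * a.eval s := by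
  simp only [times8, eval_add]
  omega

@[simp] theorem eval_min : (min a b).eval s = Min.min (a.eval s) (b.eval s) := by
  simp only [min, eval_sub]
  omega

@[simp] theorem eval_not_eq_zero : (not a).eval s = 0 ↔ ¬ a.eval s = 0 := by
  simp only [not, eval_sub, eval_lit]
  omega

@[simp] theorem eval_and_eq_zero :
    (and a b).eval s = 0 ↔ ¬ (¬ a.eval s = 0 ∧ ¬ b.eval s = 0) := by
  simp only [and, not, eval_sub, eval_add, eval_lit]
  omega

@[simp] theorem eval_or_eq_zero : (or a b).eval s = 0 ↔ ¬ (¬ a.eval s = 0 ∨ ¬ b.eval s = 0) := by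
  simp only [or, eval_add]
  omega

@[simp] theorem eval_lt_eq_zero : (lt a b).eval s = 0 ↔ ¬ a.eval s < b.eval s := by
  simp only [lt, eval_sub]
  omega

@[simp] theorem eval_le_eq_zero : (le a b).eval s = 0 ↔ ¬ a.eval s ≤ b.eval s := by
  simp only [le, not, eval_sub, eval_lit]
  omega

@[simp] theorem eval_eq_eq_zero : (eq a b).eval s = 0 ↔ ¬ a.eval s = b.eval s := by
  simp only [eq, not, eval_sub, eval_add, eval_lit]
  omega

end Expr

@[simp] theorem State.reg_setReg (s : State) (r v r' : ℕ) :
    (s.setReg r v).reg r' = if r' = r then v else s.reg r' := by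
  simp [State.setReg, Function.update_apply]

@[simp] theorem State.mem_setReg (s : State) (r v : ℕ) : (s.setReg r v).mem = s.mem := rfl

@[simp] theorem State.reg_setMem (s : State) (a v : ℕ) : (s.setMem a v).reg = s.reg := rfl

@[simp] theorem State.mem_setMem (s : State) (a v a' : ℕ) :
    (s.setMem a v).mem a' = if a' = a then v else s.mem a' := by
  simp [State.setMem, Function.update_apply]

namespace Cmd

/-- Sequential composition of commands. -/
infixr:60 " ;; " => Cmd.seq

variable (K : ℕ) (Q : State → Prop) (s : State)

@[simp] theorem wp_skip : skip.wp K Q s ↔ Q s := Iff.rfl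
@[simp] theorem wp_set (v : ℕ) (e : Expr) :
    (set v e).wp K Q s ↔ e.Ok s ∧ Q (s.setReg v (e.eval s)) := Iff.rfl
@[simp] theorem wp_store (a e : Expr) :
    (store a e).wp K Q s ↔ (a.Ok s ∧ e.Ok s) ∧ Q (s.setMem (a.eval s) (e.eval s)) := Iff.rfl
@[simp] theorem wp_seq (p q : Cmd) : (p ;; q).wp K Q s ↔ p.wp K (q.wp K Q) s := Iff.rfl
@[simp] theorem wp_ite (e : Expr) (p q : Cmd) : (ite e p q).wp K Q s ↔
    e.Ok s ∧ (¬ e.eval s = 0 → p.wp K Q s) ∧ (e.eval s = 0 → q.wp K Q s) := Iff.rfl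

/-- Store the values of the given variables at consecutive addresses, the first of which is the
value of the variable `v` plus `o`. -/
def storeVars (v : ℕ) : ℕ → List ℕ → Cmd
  | _, [] => skip
  | o, r :: l => store (.var v + .lit o) (.var r) ;; storeVars v (o + 1) l

variable {K Q}

theorem wp_storeVars {v : ℕ} {l : List ℕ} : ∀ {o : ℕ} {s : State},
    (∀ mem', SegAt mem' (s.reg v + o) (l.map s.reg) →
      (∀ a, a < s.reg v + o ∨ s.reg v + o + l.length ≤ a → mem' a = s.mem a) →
      Q ⟨s.reg, mem'⟩) → (storeVars v o l).wp K Q s := by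
  induction l with
  | nil => exact fun h => h _ (by simp [SegAt]) fun _ _ => rfl
  | cons r l ih =>
    intro o s h
    refine ⟨⟨by simp, by simp⟩, ih fun mem' hseg hrest => h mem' ?_ fun a ha => ?_⟩
    · rw [List.map_cons, segAt_cons]
      refine ⟨?_, hseg⟩
      rw [hrest _ (by simp)]
      simp
    · rw [List.length_cons] at ha
      rw [hrest a (by simp only [State.reg_setMem]; omega)]
      simp only [State.mem_setMem, Expr.eval_add, Expr.eval_var, Expr.eval_lit]
      rw [if_neg (by omega)]

end Cmd

end Ram

namespace Evacuation

open Ram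

namespace Instance

variable (I : Instance)

/-- The part of the encoding that belongs to an arc. -/
def arcBlock (e : Fin I.nA) : List ℕ :=
  [(I.tail e).toNat, (I.head e).toNat, (I.travel e).num, (I.travel e).den,
      (I.cap e).num, (I.cap e).den] ++
    WithTop.recTopCoe (C := fun _ => List ℕ) [0, 0] (fun f => [f.num, f.den]) (I.close e)

/-- The part of the encoding that belongs to an area. -/
def areaBlock (k : Fin I.nE) : List ℕ :=
  [I.demand k, (I.path k).length] ++ (I.path k).map fun e => (e : ℕ)

theorem areaBlock_eq (k : Fin I.nE) :
    I.areaBlock k = [I.demand k, (I.path k).length] ++ (I.path k).map Fin.val := by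
  simp only [areaBlock, List.map_id_fun', id]
  rw [List.map_eq_flatMap]
  rfl

/-- The address of the data of area number `i`. -/
def areaAddr (i : ℕ) : ℕ :=
  5 + 8 * I.nA + (((List.finRange I.nE).take i).flatMap I.areaBlock).length

theorem length_arcBlock (e : Fin I.nA) : (I.arcBlock e).length = 8 := by
  unfold arcBlock
  cases I.close e <;> simp

theorem encode_eq : I.encode = [I.nE, I.nT, I.nS, I.nA, I.horizon] ++
    (List.finRange I.nA).flatMap I.arcBlock ++ (List.finRange I.nE).flatMap I.areaBlock := rfl

theorem length_flatMap_arcBlock :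
    ((List.finRange I.nA).flatMap I.arcBlock).length = 8 * I.nA := by
  have := length_flatMap_take_finRange I.length_arcBlock le_rfl
  rwa [List.take_of_length_le (by simp)] at this

theorem areaAddr_succ (k : Fin I.nE) :
    I.areaAddr (k + 1) = I.areaAddr k + 2 + (I.path k).length := by
  rw [areaAddr, areaAddr, take_finRange_succ, List.flatMap_append, List.length_append]
  simp [areaBlock]
  omega

theorem areaAddr_nE : I.areaAddr I.nE = I.encode.length := by
  rw [areaAddr, encode_eq, List.take_of_length_le (by simp), List.length_append,
    List.length_append, length_flatMap_arcBlock]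
  rfl

theorem areaAddr_add_le (k : Fin I.nE) :
    I.areaAddr k + 2 + (I.path k).length ≤ I.encode.length := by
  have key : ∀ j, (k : ℕ) + 1 ≤ j → j ≤ I.nE → I.areaAddr (k + 1) ≤ I.areaAddr j := by
    intro j hj
    induction j, hj using Nat.le_induction with
    | base => exact fun _ => le_rfl
    | succ j _ ih =>
      intro hle
      have h₁ := I.areaAddr_succ ⟨j, hle⟩
      have h₂ := ih (by omega)
      simp only at h₁
      omega
  rw [← areaAddr_succ, ← areaAddr_nE]
  exact key _ k.2 le_rfl

/-- Bounds the loops over areas and items, and the space needed for the output, by the input length.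
-/
theorem nE_le_length : 5 + I.nE ≤ I.encode.length := by
  have key : ∀ i ≤ I.nE, 5 + i ≤ I.areaAddr i := by
    intro i
    induction i with
    | zero => simp [areaAddr]
    | succ i ih =>
      intro hi
      have := I.areaAddr_succ ⟨i, hi⟩
      have := ih (by omega)
      simp only at *
      omega
  rw [← areaAddr_nE]
  exact key _ le_rfl

variable {I} {mem : ℕ → ℕ}

theorem segAt_header (h : SegAt mem 0 I.encode) : mem 0 = I.nE ∧ mem 3 = I.nA ∧
    mem 4 = I.horizon := by
  rw [encode_eq, List.append_assoc, segAt_append] at h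
  exact ⟨by simpa using h.1 0 (by simp), by simpa using h.1 3 (by simp),
    by simpa using h.1 4 (by simp)⟩

theorem segAt_arcBlock (h : SegAt mem 0 I.encode) (e : Fin I.nA) :
    SegAt mem (5 + 8 * e) (I.arcBlock e) := by
  rw [encode_eq, List.append_assoc, segAt_append, segAt_append, segAt_flatMap_iff] at h
  have := h.2.1 e
  rw [length_flatMap_take_finRange I.length_arcBlock e.2.le] at this
  simpa using this

theorem segAt_areaBlock (h : SegAt mem 0 I.encode) (k : Fin I.nE) :
    SegAt mem (I.areaAddr k) (I.areaBlock k) := by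
  rw [encode_eq, segAt_append, segAt_flatMap_iff] at h
  have := h.2 k
  rw [List.length_append, length_flatMap_arcBlock] at this
  simpa [areaAddr, add_assoc] using this

end Instance

end Evacuation

/-! ## Reading an instance -/

namespace Evacuation

open Ram Ram.Expr Ram.Cmd

/-- Read the next arc of a path. Variables: 3 is the input pointer, 7 the travel time, 8 the cutoff
time, 9 the flow rate, 10 the arc, 11 the address of its data. -/
def readArc : Cmd :=
  set 10 (mem (var 3)) ;;
  set 3 (var 3 + lit 1) ;;
  set 11 (lit 5 + times8 (var 10)) ;;
  set 12 ((mem (var 11 + lit 2) + mem (var 11 + lit 3) - lit 1) / mem (var 11 + lit 3)) ;;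
  set 7 (var 7 + var 12) ;;
  set 8 (var 8 + var 12) ;;
  ite (mem (var 11 + lit 7))
    (set 8 (Expr.min (var 8) (mem (var 11 + lit 6) / mem (var 11 + lit 7)))) skip ;;
  set 9 (Expr.min (var 9) (mem (var 11 + lit 4) / mem (var 11 + lit 5)))

/-- Read the data of the next area and store the records of its two items. Variables: 2 is the
horizon, 3 the input pointer, 4 the output pointer, 5 is set to zero if the instance is not
admissible, 6 is the demand, and 14 to 19 are entries of the records. -/
def readArea : Cmd :=
  set 6 (mem (var 3)) ;;
  set 12 (mem (var 3 + lit 1)) ;;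
  set 3 (var 3 + lit 2) ;;
  set 7 (lit 0) ;;
  set 8 (var 2) ;;
  set 9 (var 6) ;;
  rep (var 12) readArc ;;
  set 8 (Expr.min (var 8) (var 2)) ;;
  ite (or (lt (var 9) (lit 1)) (lt (var 8) (var 7))) (set 5 (lit 0)) skip ;;
  set 14 (var 9 + lit 1) ;;
  set 15 (var 6 / var 9) ;;
  set 16 (var 8 - var 7) ;;
  set 17 (lit 0) ;;
  set 18 (var 6 - mul (var 15) (var 9) (var 6)) ;;
  set 19 (Expr.min (lit 1) (var 18)) ;;
  set 18 (var 18 + lit 1) ;;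
  storeVars 4 0 [14, 15, 7, 10, 16, 17, 6, 9, 18, 19, 7, 10, 16, 17, 6, 9] ;;
  set 4 (var 4 + lit 16)

variable {I : Instance} {K : ℕ}

/-- The program detects an arc that never closes by the denominator 0 of its closing time. -/
theorem wp_readArc {s : State} {e : Fin I.nA} (harc : SegAt s.mem (5 + 8 * e) (I.arcBlock e))
    (he : s.mem (s.reg 3) = e) : readArc.wp K (fun s' => s'.mem = s.mem ∧
      s'.reg 3 = s.reg 3 + 1 ∧ s'.reg 7 = s.reg 7 + I.arcTime e ∧
      s'.reg 8 = I.cutoff (s.reg 8) e ∧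
      s'.reg 9 = min (s.reg 9) ((I.cap e).num / (I.cap e).den) ∧ s'.reg 10 = e ∧
      ∀ r, r ∉ [3, 7, 8, 9, 10, 11, 12] → s'.reg r = s.reg r) s := by
  have hlen := I.length_arcBlock e
  have h2 := harc 2 (by omega)
  have h3 := harc 3 (by omega)
  have h4 := harc 4 (by omega)
  have h5 := harc 5 (by omega)
  have h6 := harc 6 (by omega)
  have h7 := harc 7 (by omega)
  have ht : I.arcTime e = ((I.travel e).num + (I.travel e).den - 1) / (I.travel e).den :=
    natCeil_nnrat _
  cases hc : I.close e with
  | top =>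
    simp only [Instance.arcBlock, hc, WithTop.recTopCoe_top] at h2 h3 h4 h5 h6 h7
    simp [-List.mem_cons] at h2 h3 h4 h5 h6 h7
    simp [readArc, he, h2, h3, h4, h5, h6, h7, ← ht, Instance.cutoff, hc]
    intros
    simp [*]
  | coe f =>
    simp only [Instance.arcBlock, hc, WithTop.recTopCoe_coe] at h2 h3 h4 h5 h6 h7
    simp at h2 h3 h4 h5 h6 h7
    simp [readArc, he, h2, h3, h4, h5, h6, h7, ← ht, Instance.cutoff, hc]
    intros
    simp [*]

/-- Path time, completion time and rate are left folds, hence can be accumulated in reading order.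
Variable 10 ends as the last arc since the path is nonempty. -/
theorem wp_readPath {Q : State → Prop} {s : State} (k : Fin I.nE)
    (henc : SegAt s.mem 0 I.encode) (h3 : s.reg 3 = I.areaAddr k + 2) (h7 : s.reg 7 = 0)
    (h8 : s.reg 8 = I.horizon) (h9 : s.reg 9 = I.demand k) (h12 : s.reg 12 = (I.path k).length)
    (hK : I.encode.length ≤ K)
    (hQ : ∀ s', s'.mem = s.mem → s'.reg 3 = I.areaAddr (k + 1) → s'.reg 7 = I.pathTime k →
      s'.reg 8 = (I.path k).foldl I.cutoff I.horizon → s'.reg 9 = I.maxRate k →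
      s'.reg 10 = (I.lastArc k).val → (∀ r, r ∉ [3, 7, 8, 9, 10, 11, 12] → s'.reg r = s.reg r) → Q s') :
    (rep (var 12) readArc).wp K Q s := by
  have hle := I.areaAddr_add_le k
  refine wp_rep (fun i s' => s'.mem = s.mem ∧ s'.reg 3 = I.areaAddr k + 2 + i ∧
    s'.reg 7 = (((I.path k).take i).map I.arcTime).sum ∧
    s'.reg 8 = ((I.path k).take i).foldl I.cutoff I.horizon ∧
    s'.reg 9 = ((I.path k).take i).foldl
      (fun c e => min c ((I.cap e).num / (I.cap e).den)) (I.demand k) ∧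
    (∀ e, ((I.path k).take i).getLast? = some e → s'.reg 10 = e) ∧
    ∀ r, r ∉ [3, 7, 8, 9, 10, 11, 12] → s'.reg r = s.reg r) (I.path k).length trivial h12
    (by omega) (by simp [*]) ?_ ?_
  · rintro i hi s' ⟨hm, h3', h7', h8', h9', -, hr⟩
    set e := (I.path k)[i] with he
    have harea : SegAt s'.mem (I.areaAddr k) (I.areaBlock k) :=
      Instance.segAt_areaBlock (by rwa [hm]) k
    have hread : s'.mem (s'.reg 3) = e := by
      rw [h3', he]
      rw [Instance.areaBlock_eq] at harea
      exact ((segAt_append.1 harea).2 i (by simpa using hi)).trans (List.getElem_map _)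
    refine wp_mono _ ?_ (wp_readArc (Instance.segAt_arcBlock (by rwa [hm]) e) hread)
    rintro s'' ⟨g, g3, g7, g8, g9, g10, gr⟩
    rw [List.take_succ_eq_append_getElem hi, ← he]
    refine ⟨g.trans hm, by omega, ?_, ?_, ?_, ?_, fun r hr' => (gr r hr').trans (hr r hr')⟩
    · simp [g7, h7']
    · simp [g8, h8']
    · simp [g9, h9']
    · simp [g10]
  · rintro s' ⟨hm, h3', h7', h8', h9', h10', hr⟩
    rw [List.take_length] at h7' h8' h9' h10'
    exact hQ s' hm (h3'.trans (I.areaAddr_succ k).symm) h7' h8' h9'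
      (h10' _ (List.getLast?_eq_getLast_of_ne_nil (I.path_ne_nil k))) hr

/-- The records of the two items of an area. -/
def itemBlock (I : Instance) (k : Fin I.nE) : List ℕ :=
  [I.maxRate k + 1, I.demand k / I.maxRate k, I.pathTime k, I.lastArc k,
    I.completion k - I.pathTime k, 0, I.demand k, I.maxRate k,
    I.demand k % I.maxRate k + 1, min 1 (I.demand k % I.maxRate k), I.pathTime k, I.lastArc k,
    I.completion k - I.pathTime k, 0, I.demand k, I.maxRate k]

/-- The state when the first `i` areas have been read. -/
structure HasRead (I : Instance) (base i : ℕ) (s : State) : Prop where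
  encode : SegAt s.mem 0 I.encode
  reg0 : s.reg 0 = I.encode.length
  reg1 : s.reg 1 = I.nE
  reg2 : s.reg 2 = I.horizon
  reg13 : s.reg 13 = base
  reg3 : s.reg 3 = I.areaAddr i
  reg4 : s.reg 4 = base + 16 * i
  reg5 : s.reg 5 = 0 ↔ ¬ ∀ k : Fin I.nE, k < i → 1 ≤ I.maxRate k ∧ I.pathTime k ≤ I.completion k
  items : ∀ k : Fin I.nE, k < i → SegAt s.mem (base + 16 * k) (itemBlock I k)

/-- Records are written even for areas that fail the test, where division by a zero rate yields 0;
the flag in variable 5 then makes them irrelevant. -/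
theorem wp_readArea {base : ℕ} {s : State} (k : Fin I.nE) (hbase : I.encode.length ≤ base)
    (hK : I.encode.length ≤ K) (h : HasRead I base k s) :
    readArea.wp K (HasRead I base (k + 1)) s := by
  have harea := Instance.segAt_areaBlock h.encode k
  have hd : s.mem (I.areaAddr k) = I.demand k := by
    simpa [Instance.areaBlock] using harea 0 (by simp [Instance.areaBlock])
  have hl : s.mem (I.areaAddr k + 1) = (I.path k).length := by
    simpa [Instance.areaBlock] using harea 1 (by simp [Instance.areaBlock])
  simp only [readArea, wp_seq, wp_set, ok_mem, ok_var, ok_lit, ok_add, true_and, and_self]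
  refine wp_readPath k (by simpa using h.encode) (by simp [h.reg3]) (by simp) (by simp [h.reg2])
    (by simp [h.reg3, hd]) (by simp [h.reg3, hl]) hK ?_
  intro s' hm h3 h7 h8 h9 h10 hr
  have e0 := hr 0 (by decide)
  have e1 := hr 1 (by decide)
  have e2 := hr 2 (by decide)
  have e4 := hr 4 (by decide)
  have e5 := hr 5 (by decide)
  have e6 := hr 6 (by decide)
  have e13 := hr 13 (by decide)
  simp [h.reg0, h.reg1, h.reg2, h.reg3, h.reg4, h.reg13, hd] at e0 e1 e2 e4 e5 e6 e13 hm
  -- The code after the test is verified once for both branches; `b` is the resulting flag.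
  have finish : ∀ b : ℕ, (b = 0 ↔ ¬ ∀ l : Fin I.nE, l < (k : ℕ) + 1 →
      1 ≤ I.maxRate l ∧ I.pathTime l ≤ I.completion l) → ∀ s'' : State, s''.mem = s'.mem →
      s''.reg 5 = b → (∀ r, r ≠ 5 → r ≠ 8 → s''.reg r = s'.reg r) →
      s''.reg 8 = I.completion k →
      (set 14 (var 9 + lit 1) ;;
      set 15 (var 6 / var 9) ;;
      set 16 (var 8 - var 7) ;;
      set 17 (lit 0) ;;
      set 18 (var 6 - mul (var 15) (var 9) (var 6)) ;;
      set 19 (Expr.min (lit 1) (var 18)) ;;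
      set 18 (var 18 + lit 1) ;;
      storeVars 4 0 [14, 15, 7, 10, 16, 17, 6, 9, 18, 19, 7, 10, 16, 17, 6, 9] ;;
      set 4 (var 4 + lit 16)).wp K (HasRead I base (k + 1)) s'' := by
    intro b hb s'' hm'' h5'' hr'' h8''
    have hmod : I.demand k - I.demand k / I.maxRate k * I.maxRate k =
        I.demand k % I.maxRate k := by
      rw [Nat.mod_eq_sub_mul_div, mul_comm]
    simp only [wp_seq, wp_set, ok_var, ok_lit, ok_add, ok_sub, ok_div, ok_mul, ok_min,
      true_and, and_true]
    refine ⟨by simp [hr'', e6, h9, Nat.div_mul_le_self], wp_storeVars fun mem' hseg hrest => ?_⟩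
    simp [hr'', h8'', h7, h9, h10, e6, e4, hmod] at hseg hrest
    simp only [wp_set, ok_add, ok_var, ok_lit, true_and, and_self]
    have hold : ∀ a, a < base + 16 * k → mem' a = s.mem a := fun a ha => by
      rw [hrest a (.inl ha), hm'', hm]
    constructor
    · exact h.encode.congr fun a _ ha => hold a (by omega)
    · simp [hr'', e0]
    · simp [hr'', e1]
    · simp [hr'', e2]
    · simp [hr'', e13]
    · simp [hr'', h3]
    · simp [hr'', e4]
      ring
    · simpa [h5''] using hb
    · intro l hlk
      rcases Nat.lt_succ_iff_lt_or_eq.1 hlk with hlt | heq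
      · exact (h.items l hlt).congr fun a _ ha => hold a (by simp [itemBlock] at ha; omega)
      · obtain rfl : l = k := Fin.ext heq
        exact hseg
  have hadm : (∀ l : Fin I.nE, l < (k : ℕ) + 1 →
      1 ≤ I.maxRate l ∧ I.pathTime l ≤ I.completion l) ↔ (∀ l : Fin I.nE, l < (k : ℕ) →
      1 ≤ I.maxRate l ∧ I.pathTime l ≤ I.completion l) ∧
      (1 ≤ I.maxRate k ∧ I.pathTime k ≤ I.completion k) := by
    refine ⟨fun h => ⟨fun l hl => h l (by omega), h k (by omega)⟩, fun h l hl => ?_⟩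
    rcases Nat.lt_succ_iff_lt_or_eq.1 hl with hlt | heq
    · exact h.1 l hlt
    · obtain rfl : l = k := Fin.ext heq
      exact h.2
  refine ⟨by simp, ⟨by simp, fun hbad => ?_, fun hgood => ?_⟩⟩
  · simp [h7, h8, h9, e2] at hbad
    refine ⟨trivial, finish 0 ?_ _ rfl (by simp) (fun r h₁ h₂ => by simp [h₁, h₂])
      (by simp [h8, e2, Instance.completion])⟩
    rw [hadm]
    simp only [true_iff, Instance.completion]
    omega
  · simp [h7, h8, h9, e2] at hgood
    refine finish (s.reg 5) ?_ _ rfl (by simp [e5]) (fun r h₁ h₂ => by simp [h₂])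
      (by simp [h8, e2, Instance.completion])
    rw [h.reg5, hadm]
    have : 1 ≤ I.maxRate k ∧ I.pathTime k ≤ I.completion k := by
      simp only [Instance.completion]
      omega
    simp [this]

end Evacuation

/-! ## The greedy algorithm as a program -/

namespace Evacuation

open Ram Ram.Expr Ram.Cmd

/-- Find the item of maximal weight. Variables: 13 is the address of the first record, 15 the
number of items, 16 the maximal entry and 17 its address, 18 the current address. -/
def selectItem : Cmd :=
  set 16 (lit 0) ;;
  set 18 (var 13) ;;
  rep (var 15)
    (set 22 (mem (var 18)) ;;
    ite (lt (var 16) (var 22)) (set 16 (var 22) ;; set 17 (var 18)) skip ;;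
    set 18 (var 18 + lit 8))

/-- Truth value of the statement that the constraint with address 18 contains the item with address
17, whose travel time and last arc are the values of the variables 20 and 21. -/
def relExpr : Expr :=
  and (eq (mem (var 18 + lit 3)) (var 21))
    (or (lt (mem (var 18 + lit 2)) (var 20))
      (and (eq (mem (var 18 + lit 2)) (var 20)) (le (var 18) (var 17))))

/-- Bound the variable 19 by the residual capacities. -/
def computeSlack : Cmd :=
  set 18 (var 13) ;;
  rep (var 15)
    (ite relExpr (set 19 (Expr.min (var 19) (mem (var 18 + lit 4)))) skip ;;
    set 18 (var 18 + lit 8))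

/-- Reduce the residual capacities by the value of the variable 19. -/
def reduceCapacities : Cmd :=
  set 18 (var 13) ;;
  rep (var 15)
    (ite relExpr (store (var 18 + lit 4) (mem (var 18 + lit 4) - var 19)) skip ;;
    set 18 (var 18 + lit 8))

/-- Allocate as much as possible of the item of maximal weight. -/
def greedyStep : Cmd :=
  selectItem ;;
  set 20 (mem (var 17 + lit 2)) ;;
  set 21 (mem (var 17 + lit 3)) ;;
  set 19 (mem (var 17 + lit 1)) ;;
  computeSlack ;;
  reduceCapacities ;;
  store (var 17 + lit 5) (var 19) ;;
  store (var 17) (lit 0)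

/-- The records of the items `i < M`. The weight of an allocated item is replaced by zero, all
other weights are increased by one. -/
structure Records (base M : ℕ) (w m T L D r : ℕ → ℕ) (done : Finset ℕ) (x R mem : ℕ → ℕ) :
    Prop where
  weight : ∀ i < M, mem (base + 8 * i) = if i ∈ done then 0 else w i + 1
  bound : ∀ i < M, mem (base + 8 * i + 1) = m i
  time : ∀ i < M, mem (base + 8 * i + 2) = T i
  arc : ∀ i < M, mem (base + 8 * i + 3) = L i
  residual : ∀ i < M, mem (base + 8 * i + 4) = R i
  alloc : ∀ i < M, mem (base + 8 * i + 5) = x i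
  demand : ∀ i < M, mem (base + 8 * i + 6) = D i
  rate : ∀ i < M, mem (base + 8 * i + 7) = r i

variable {K base M : ℕ} {w m T L D r x R : ℕ → ℕ} {done : Finset ℕ}

theorem Records.setResidual {s : State} (h : Records base M w m T L D r done x R s.mem) (j v : ℕ) :
    Records base M w m T L D r done x (Function.update R j v)
      (s.setMem (base + 8 * j + 4) v).mem := by
  obtain ⟨h0, h1, h2, h3, h4, h5, h6, h7⟩ := h
  constructor <;> intro i hi <;> simp only [State.mem_setMem, Function.update_apply]
  · rw [if_neg (by omega), h0 i hi]
  · rw [if_neg (by omega), h1 i hi]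
  · rw [if_neg (by omega), h2 i hi]
  · rw [if_neg (by omega), h3 i hi]
  · by_cases hij : i = j
    · simp [hij]
    · rw [if_neg (by omega), if_neg hij, h4 i hi]
  · rw [if_neg (by omega), h5 i hi]
  · rw [if_neg (by omega), h6 i hi]
  · rw [if_neg (by omega), h7 i hi]

theorem Records.setAlloc {s : State} (h : Records base M w m T L D r done x R s.mem) (j v : ℕ) :
    Records base M w m T L D r done (Function.update x j v) R
      (s.setMem (base + 8 * j + 5) v).mem := by
  obtain ⟨h0, h1, h2, h3, h4, h5, h6, h7⟩ := h
  constructor <;> intro i hi <;> simp only [State.mem_setMem, Function.update_apply]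
  · rw [if_neg (by omega), h0 i hi]
  · rw [if_neg (by omega), h1 i hi]
  · rw [if_neg (by omega), h2 i hi]
  · rw [if_neg (by omega), h3 i hi]
  · rw [if_neg (by omega), h4 i hi]
  · by_cases hij : i = j
    · simp [hij]
    · rw [if_neg (by omega), if_neg hij, h5 i hi]
  · rw [if_neg (by omega), h6 i hi]
  · rw [if_neg (by omega), h7 i hi]

theorem Records.setDone {s : State} (h : Records base M w m T L D r done x R s.mem) (j : ℕ) :
    Records base M w m T L D r (insert j done) x R (s.setMem (base + 8 * j) 0).mem := by
  obtain ⟨h0, h1, h2, h3, h4, h5, h6, h7⟩ := h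
  constructor <;> intro i hi <;> simp only [State.mem_setMem]
  · by_cases hij : i = j
    · simp [hij]
    · rw [if_neg (by omega), h0 i hi]
      simp [hij]
  · rw [if_neg (by omega), h1 i hi]
  · rw [if_neg (by omega), h2 i hi]
  · rw [if_neg (by omega), h3 i hi]
  · rw [if_neg (by omega), h4 i hi]
  · rw [if_neg (by omega), h5 i hi]
  · rw [if_neg (by omega), h6 i hi]
  · rw [if_neg (by omega), h7 i hi]

theorem Records.congr {mem mem' R' : ℕ → ℕ} (h : Records base M w m T L D r done x R mem)
    (hmem : ∀ a, base ≤ a → mem' a = mem a) (hR : ∀ i < M, R' i = R i) :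
    Records base M w m T L D r done x R' mem' := by
  obtain ⟨h0, h1, h2, h3, h4, h5, h6, h7⟩ := h
  constructor <;> intro i hi <;> rw [hmem _ (by omega)]
  · exact h0 i hi
  · exact h1 i hi
  · exact h2 i hi
  · exact h3 i hi
  · exact (h4 i hi).trans (hR i hi).symm
  · exact h5 i hi
  · exact h6 i hi
  · exact h7 i hi

/-- Addresses increase with item numbers, so ties can be broken by comparing addresses. -/
theorem eval_relExpr {s : State} {b j : ℕ} (h : Records base M w m T L D r done x R s.mem)
    (hj : j < M) (h17 : s.reg 17 = base + 8 * b) (h18 : s.reg 18 = base + 8 * j)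
    (h20 : s.reg 20 = T b) (h21 : s.reg 21 = L b) : relExpr.eval s = 0 ↔ ¬ Rel T L j b := by
  simp [relExpr, Rel, h17, h18, h20, h21, h.arc j hj, h.time j hj]

theorem ok_relExpr (s : State) : relExpr.Ok s := by simp [relExpr]

/-- The shift of the weights by one makes unallocated items positive, so the maximum is found at one
of them even if its true weight is zero. Until a positive entry has been met, nothing is known about
variable 17. -/
theorem wp_selectItem {Q : State → Prop} {s : State} (hK : M ≤ K)
    (h : Records base M w m T L D r done x R s.mem) (h13 : s.reg 13 = base) (h15 : s.reg 15 = M)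
    (hdone : ∃ i < M, i ∉ done)
    (hQ : ∀ s' b, b < M → b ∉ done → (∀ i < M, i ∉ done → w i ≤ w b) → s'.mem = s.mem →
      s'.reg 17 = base + 8 * b → (∀ r, r ∉ [16, 17, 18, 22] → s'.reg r = s.reg r) → Q s') :
    selectItem.wp K Q s := by
  simp only [selectItem, wp_seq, wp_set, ok_lit, ok_var, true_and]
  refine wp_rep (fun j s' => s'.mem = s.mem ∧ s'.reg 18 = base + 8 * j ∧
    (∀ i < j, s.mem (base + 8 * i) ≤ s'.reg 16) ∧
    (s'.reg 16 ≠ 0 → ∃ b < j, s'.reg 17 = base + 8 * b ∧ s'.reg 16 = s.mem (base + 8 * b)) ∧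
    ∀ r, r ∉ [16, 17, 18, 22] → s'.reg r = s.reg r) M trivial (by simpa using h15) hK ?_ ?_ ?_
  · simp [h13]
    intros
    simp_all
  · rintro j hj s' ⟨hm, h18, hmax, harg, hr⟩
    simp [hm, h18]
    have step : ∀ i ≤ j, i < j ∨ i = j := fun i hi => Nat.lt_or_eq_of_le hi
    refine ⟨fun hlt => ⟨by omega, fun i hi => ?_, ?_⟩,
      fun hle => ⟨by omega, fun i hi => ?_, fun hne => ?_, ?_⟩⟩
    · rcases step i hi with hi | rfl
      · exact (hmax i hi).trans hlt.le
      · exact le_rfl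
    · intro r h₁ h₂ h₃ h₄
      simp [h₁, h₂, h₃, h₄, hr r]
    · rcases step i hi with hi | rfl
      · exact hmax i hi
      · exact hle
    · obtain ⟨b, hb, h₁, h₂⟩ := harg hne
      exact ⟨b, by omega, h₁, h₂⟩
    · intro r h₁ h₂ h₃ h₄
      simp [h₁, h₂, h₃, h₄, hr r]
  · rintro s' ⟨hm, -, hmax, harg, hr⟩
    obtain ⟨i₀, hi₀, hid₀⟩ := hdone
    have h₀ := hmax i₀ hi₀
    rw [h.weight i₀ hi₀, if_neg hid₀] at h₀
    obtain ⟨b, hb, h17, h16⟩ := harg (by omega)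
    rw [h.weight b hb] at h16
    have hbd : b ∉ done := fun hbd => by
      rw [if_pos hbd] at h16
      omega
    rw [if_neg hbd] at h16
    refine hQ s' b hb hbd (fun i hi hid => ?_) hm h17 hr
    have := hmax i hi
    rw [h.weight i hi, if_neg hid] at this
    omega

theorem wp_computeSlack {Q : State → Prop} {s : State} {b : ℕ} (hK : M ≤ K)
    (h : Records base M w m T L D r done x R s.mem) (h13 : s.reg 13 = base) (h15 : s.reg 15 = M)
    (h17 : s.reg 17 = base + 8 * b) (h19 : s.reg 19 = m b) (h20 : s.reg 20 = T b)
    (h21 : s.reg 21 = L b)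
    (hQ : ∀ s', s'.mem = s.mem → s'.reg 19 ≤ m b → (∀ j < M, Rel T L j b → s'.reg 19 ≤ R j) →
      (s'.reg 19 = m b ∨ ∃ j < M, Rel T L j b ∧ s'.reg 19 = R j) →
      (∀ r, r ∉ [18, 19] → s'.reg r = s.reg r) → Q s') :
    computeSlack.wp K Q s := by
  simp only [computeSlack, wp_seq, wp_set, ok_var, true_and]
  refine wp_rep (fun i s' => s'.mem = s.mem ∧ s'.reg 18 = base + 8 * i ∧ s'.reg 19 ≤ m b ∧
    (∀ j < i, Rel T L j b → s'.reg 19 ≤ R j) ∧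
    (s'.reg 19 = m b ∨ ∃ j < i, Rel T L j b ∧ s'.reg 19 = R j) ∧
    ∀ r, r ∉ [18, 19] → s'.reg r = s.reg r) M trivial (by simpa using h15) hK ?_ ?_ ?_
  · simp [h13, h19]
    intros
    simp_all
  · rintro i hi s' ⟨hm, h18, hle, hall, hex, hr⟩
    have hrel := eval_relExpr (s := s') (b := b) (by rwa [hm]) hi
      ((hr 17 (by decide)).trans h17) h18 ((hr 20 (by decide)).trans h20)
      ((hr 21 (by decide)).trans h21)
    have step : ∀ j ≤ i, j < i ∨ j = i := fun j hj => Nat.lt_or_eq_of_le hj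
    simp [ok_relExpr, hrel, hm, h18, h.residual i hi]
    refine ⟨fun hib => ⟨by omega, .inl hle, fun j hj hjb => ?_, ?_, ?_⟩,
      fun hib => ⟨by omega, hle, fun j hj hjb => ?_, ?_, ?_⟩⟩
    · rcases step j hj with hj | rfl
      · exact .inl (hall j hj hjb)
      · exact .inr le_rfl
    · rcases le_total (s'.reg 19) (R i) with hR | hR
      · rw [min_eq_left hR]
        rcases hex with hex | ⟨j, hj, hjb, hex⟩
        · exact .inl hex
        · exact .inr ⟨j, by omega, hjb, hex⟩
      · exact .inr ⟨i, by omega, hib, min_eq_right hR⟩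
    · intro r h₁ h₂
      simp [h₁, h₂, hr r]
    · rcases step j hj with hj | rfl
      · exact hall j hj hjb
      · exact absurd hjb hib
    · rcases hex with hex | ⟨j, hj, hjb, hex⟩
      · exact .inl hex
      · exact .inr ⟨j, by omega, hjb, hex⟩
    · intro r h₁ h₂
      simp [h₁, h₂, hr r]
  · rintro s' ⟨hm, -, hle, hall, hex, hr⟩
    exact hQ s' hm hle hall hex hr

/-- The loop changes residual fields only, while the relation reads travel times and arcs, so it can
be tested in the course of the updates. -/
theorem wp_reduceCapacities {Q : State → Prop} {s : State} {b : ℕ} (hK : M ≤ K)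
    (h : Records base M w m T L D r done x R s.mem) (h13 : s.reg 13 = base) (h15 : s.reg 15 = M)
    (h17 : s.reg 17 = base + 8 * b) (h20 : s.reg 20 = T b) (h21 : s.reg 21 = L b)
    (hQ : ∀ s', Records base M w m T L D r done x
        (fun j => if Rel T L j b then R j - s.reg 19 else R j) s'.mem →
      (∀ r, r ∉ [18] → s'.reg r = s.reg r) → Q s') :
    reduceCapacities.wp K Q s := by
  simp only [reduceCapacities, wp_seq, wp_set, ok_var, true_and]
  refine wp_rep (fun i s' => Records base M w m T L D r done x
    (fun j => if j < i ∧ Rel T L j b then R j - s.reg 19 else R j) s'.mem ∧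
    s'.reg 18 = base + 8 * i ∧ ∀ r, r ∉ [18] → s'.reg r = s.reg r) M trivial
    (by simpa using h15) hK ?_ ?_ ?_
  · simp [h13, h]
    intros
    simp_all
  · rintro i hi s' ⟨hrec, h18, hr⟩
    have hrel := eval_relExpr (s := s') (b := b) hrec hi
      ((hr 17 (by decide)).trans h17) h18 ((hr 20 (by decide)).trans h20)
      ((hr 21 (by decide)).trans h21)
    have h19 := hr 19 (by decide)
    have hres := hrec.residual i hi
    simp only [lt_self_iff_false, false_and, if_false] at hres
    simp only [wp_seq, wp_ite, wp_store, wp_skip, wp_set, hrel, ok_relExpr, ok_add, ok_sub, ok_mem, ok_var,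
      ok_lit, eval_add, eval_sub, eval_mem, eval_var, eval_lit, h18, h19, hres, true_and,
      not_not, State.mem_setReg, State.reg_setReg, State.reg_setMem]
    refine ⟨fun hib => ⟨?_, by simp; omega, ?_⟩, fun hib => ⟨?_, by simp; omega, ?_⟩⟩
    · have e := hrec.setResidual i (R i - s.reg 19)
      refine e.congr (fun _ _ => rfl) fun j _ => ?_
      rw [Function.update_apply]
      by_cases hji : j = i
      · subst hji
        simp [hib]
      · have : j < i + 1 ↔ j < i := by omega
        simp [hji, this]
    · intro r h₁
      have : r ≠ 18 := by simpa using h₁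
      simp [this, hr r h₁]
    · refine hrec.congr (fun _ _ => rfl) fun j _ => ?_
      by_cases hji : j = i
      · subst hji
        simp [hib]
      · have : j < i + 1 ↔ j < i := by omega
        simp [this]
    · intro r h₁
      have : r ≠ 18 := by simpa using h₁
      simp [this, hr r h₁]
  · rintro s' ⟨hrec, -, hr⟩
    exact hQ s' (hrec.congr (fun _ _ => rfl) fun j hj => by simp [hj]) hr

/-- The slack is the minimum of the item's bound and of the residual capacities of its constraints,
which is what `Greedy.Inv.step` asks of the allocated amount. -/
theorem wp_greedyStep {cap : ℕ → ℕ} {s : State} (hK : M ≤ K)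
    (h : Records base M w m T L D r done x R s.mem)
    (hinv : Greedy.Inv M w m cap (Rel T L) done x R) (hcard : done.card < M)
    (h13 : s.reg 13 = base) (h15 : s.reg 15 = M) :
    greedyStep.wp K (fun s' => ∃ done' x' R', done'.card = done.card + 1 ∧
      Greedy.Inv M w m cap (Rel T L) done' x' R' ∧
      Records base M w m T L D r done' x' R' s'.mem ∧
      ∀ r, r ∉ [16, 17, 18, 19, 20, 21, 22] → s'.reg r = s.reg r) s := by
  have hex : ∃ i < M, i ∉ done := by
    by_contra hno
    push Not at hno
    have := Finset.card_le_card fun i hi => hno i (Finset.mem_range.1 hi)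
    rw [Finset.card_range] at this
    omega
  simp only [greedyStep, wp_seq]
  refine wp_selectItem hK h h13 h15 hex fun s₁ b hb hbd hmax hm₁ h17 hr₁ => ?_
  simp only [wp_seq, wp_set, ok_mem, ok_add, ok_var, ok_lit, and_self, true_and]
  have e13 := (hr₁ 13 (by decide)).trans h13
  have e15 := (hr₁ 15 (by decide)).trans h15
  refine wp_computeSlack (b := b) hK (by simpa [hm₁] using h) (by simpa using e13)
    (by simpa using e15) (by simpa using h17) (by simp [h17, hm₁, h.bound b hb])
    (by simp [h17, hm₁, h.time b hb]) (by simp [h17, hm₁, h.arc b hb]) ?_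
  intro s₂ hm₂ hle hall hsat hr₂
  simp only [State.mem_setReg, hm₁] at hm₂
  have f13 := hr₂ 13 (by decide)
  have f15 := hr₂ 15 (by decide)
  have f17 := hr₂ 17 (by decide)
  have f20 := hr₂ 20 (by decide)
  have f21 := hr₂ 21 (by decide)
  simp [e13, e15, h17, hm₁, h.time b hb, h.arc b hb] at f13 f15 f17 f20 f21
  refine wp_reduceCapacities (b := b) hK (by rwa [hm₂]) f13 f15 f17 f20 f21 ?_
  intro s₃ hrec hr₃
  have g17 := (hr₃ 17 (by decide)).trans f17
  have g19 := hr₃ 19 (by decide)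
  refine ⟨by simp, by simp, insert b done, Function.update x b (s₂.reg 19), _,
    Finset.card_insert_of_notMem hbd, hinv.step hb hbd hmax hle hall hsat, ?_, ?_⟩
  · have := (hrec.setAlloc b (s₂.reg 19)).setDone b
    simpa [g17, g19] using this
  · intro r hr
    simp only [List.mem_cons, List.not_mem_nil, or_false, not_or] at hr
    have e₁ := hr₁ r (by simp [hr])
    have e₂ := hr₂ r (by simp [hr])
    have e₃ := hr₃ r (by simp [hr])
    simp [hr] at e₂
    simp [e₃, e₂, e₁]

end Evacuation

/-! ## The complete algorithm -/

namespace Evacuation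

open Ram Ram.Expr Ram.Cmd

/-- Write the schedule of the next area. Variables: 18 is the address of its records, 23 the output
pointer. -/
def writeArea : Cmd :=
  set 16 (mem (var 18 + lit 5) + mem (var 18 + lit 13)) ;;
  set 17 (mem (var 18 + lit 7)) ;;
  set 19 (mem (var 18 + lit 6)) ;;
  set 20 (mem (var 18 + lit 4)) ;;
  set 21 (var 20 + var 16) ;;
  set 22 (Expr.min (mul (var 16) (var 17) (var 19 + var 19)) (var 19)) ;;
  storeVars 23 0 [22, 17, 20, 16, 21] ;;
  set 23 (var 23 + lit 5) ;;
  set 18 (var 18 + lit 16)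

/-- Write the whole schedule. -/
def writeSchedule : Cmd :=
  store (lit 0) (lit 1) ;;
  set 23 (lit 1) ;;
  set 18 (var 13) ;;
  rep (var 1) writeArea ;;
  set 0 (var 23)

/-- The algorithm that computes an optimal schedule. -/
def solve : Cmd :=
  set 1 (mem (lit 0)) ;;
  set 2 (mem (lit 4)) ;;
  set 3 (lit 5 + times8 (mem (lit 3))) ;;
  set 13 (times8 (var 0)) ;;
  set 4 (var 13) ;;
  set 5 (lit 1) ;;
  rep (var 1) readArea ;;
  ite (var 5)
    (set 15 (var 1 + var 1) ;; rep (var 15) greedyStep ;; writeSchedule)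
    (store (lit 0) (lit 0) ;; set 0 (lit 1))

variable {I : Instance} {K base : ℕ} {w m T L D r cap x R : ℕ → ℕ} {done : Finset ℕ}

/-- The part of the encoding of a schedule that belongs to an area. -/
def scheduleBlock {n : ℕ} (S : Schedule n) (k : Fin n) : List ℕ :=
  [S.flow k, S.rate k, S.start k, S.dur k, S.finish k]

theorem encode_some {n : ℕ} (S : Schedule n) : Answer.encode (some ⟨n, S⟩) =
    1 :: (List.finRange n).flatMap (scheduleBlock S) := rfl

/-- The state when the schedules of the first `i` areas have been written. -/
structure HasWritten (I : Instance) (base : ℕ) (w m T L D r : ℕ → ℕ) (x R : ℕ → ℕ) (i : ℕ)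
    (s : State) : Prop where
  records : Records base (2 * I.nE) w m T L D r (Finset.range (2 * I.nE)) x R s.mem
  reg18 : s.reg 18 = base + 16 * i
  reg23 : s.reg 23 = 1 + 5 * i
  head : s.mem 0 = 1
  blocks : ∀ k : Fin I.nE, k < i → SegAt s.mem (1 + 5 * k) (scheduleBlock (scheduleOf I x R) k)

/-- The output may overwrite the input, which is no longer needed; `hbase` keeps it clear of the
records. -/
theorem wp_writeArea {s : State} (k : Fin I.nE) (hbase : 1 + 5 * I.nE ≤ base)
    (hx : ∀ k : Fin I.nE, (x (2 * k) + x (2 * k + 1)) * I.maxRate k ≤ I.demand k + I.demand k)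
    (hD : ∀ k : Fin I.nE, D (2 * k) = I.demand k) (hr : ∀ k : Fin I.nE, r (2 * k) = I.maxRate k)
    (h : HasWritten I base w m T L D r x R k s) :
    writeArea.wp K (HasWritten I base w m T L D r x R (k + 1)) s := by
  have hk := k.2
  have a₁ : base + 16 * (k : ℕ) = base + 8 * (2 * k) := by ring
  have a₂ : base + 16 * (k : ℕ) + 13 = base + 8 * (2 * k + 1) + 5 := by ring
  have e5 := h.records.alloc (2 * k) (by omega)
  have e13 := h.records.alloc (2 * k + 1) (by omega)
  have e7 := (h.records.rate (2 * k) (by omega)).trans (hr k)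
  have e6 := (h.records.demand (2 * k) (by omega)).trans (hD k)
  have e4 := h.records.residual (2 * k) (by omega)
  rw [← a₁] at e5 e7 e6 e4
  rw [← a₂] at e13
  simp only [writeArea, wp_seq, wp_set, ok_var, ok_lit, ok_add, ok_mem, ok_min, ok_mul, and_true,
    true_and, and_self]
  refine ⟨by simp [h.reg18, e5, e13, e7, e6, hx k], wp_storeVars fun mem' hseg hrest => ?_⟩
  simp [h.reg18, h.reg23, e5, e13, e7, e6, e4] at hseg hrest
  simp only [wp_seq, wp_set, ok_add, ok_var, ok_lit, true_and, and_self]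
  constructor
  · exact h.records.congr (fun a ha => hrest a (.inr (by omega))) fun _ _ => rfl
  · simp [h.reg18]
    ring
  · simp [h.reg23]
    ring
  · exact (hrest 0 (.inl (by omega))).trans h.head
  · intro l hlk
    rcases Nat.lt_succ_iff_lt_or_eq.1 hlk with hlt | heq
    · refine (h.blocks l hlt).congr fun a _ ha => hrest a (.inl ?_)
      simp only [scheduleBlock, List.length_cons, List.length_nil] at ha
      omega
    · obtain rfl : l = k := Fin.ext heq
      exact hseg

theorem wp_writeSchedule {s : State} (hbase : 1 + 5 * I.nE ≤ base) (hK : I.nE ≤ K)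
    (hx : ∀ k : Fin I.nE, (x (2 * k) + x (2 * k + 1)) * I.maxRate k ≤ I.demand k + I.demand k)
    (hD : ∀ k : Fin I.nE, D (2 * k) = I.demand k) (hr : ∀ k : Fin I.nE, r (2 * k) = I.maxRate k)
    (h : Records base (2 * I.nE) w m T L D r (Finset.range (2 * I.nE)) x R s.mem)
    (h1 : s.reg 1 = I.nE) (h13 : s.reg 13 = base) :
    writeSchedule.wp K
      (fun s' => s'.output = Answer.encode (some ⟨I.nE, scheduleOf I x R⟩)) s := by
  simp only [writeSchedule, wp_seq, wp_set, wp_store, ok_var, ok_lit, true_and]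
  refine wp_rep (HasWritten I base w m T L D r x R) I.nE trivial (by simp [h1]) hK ?_
    (fun i hi s' hs' => wp_writeArea ⟨i, hi⟩ hbase hx hD hr hs') fun s' hs' => ?_
  · constructor
    · refine h.congr (fun a ha => ?_) fun _ _ => rfl
      simp only [State.mem_setReg, State.mem_setMem, eval_lit]
      rw [if_neg (by omega)]
    · simp [h13]
    · simp
    · simp
    · simp
  · simp only [wp_set, ok_var, true_and]
    have hlen : ∀ k, (scheduleBlock (scheduleOf I x R) k).length = 5 := fun _ => rfl
    have htotal := length_flatMap_take_finRange hlen le_rfl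
    rw [List.take_of_length_le (by simp)] at htotal
    rw [encode_some]
    refine State.output_eq ?_ ?_
    · rw [segAt_cons]
      refine ⟨hs'.head, segAt_flatMap_iff.2 fun k => ?_⟩
      rw [length_flatMap_take_finRange hlen k.2.le]
      simpa using hs'.blocks k k.2
    · rw [List.length_cons, htotal]
      simp [hs'.reg23, add_comm]

/-- Repeating the greedy step allocates all items. -/
theorem wp_greedy {M : ℕ} {Q : State → Prop} {s : State} (hK : M ≤ K)
    (h : Records base M w m T L D r ∅ (fun _ => 0) cap s.mem)
    (h13 : s.reg 13 = base) (h15 : s.reg 15 = M)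
    (hQ : ∀ s' x R, Greedy.Inv M w m cap (Rel T L) (Finset.range M) x R →
      Records base M w m T L D r (Finset.range M) x R s'.mem →
      (∀ r, r ∉ [16, 17, 18, 19, 20, 21, 22] → s'.reg r = s.reg r) → Q s') :
    (rep (var 15) greedyStep).wp K Q s := by
  refine wp_rep (fun i s' => ∃ done x R, done.card = i ∧
    Greedy.Inv M w m cap (Rel T L) done x R ∧ Records base M w m T L D r done x R s'.mem ∧
    ∀ r, r ∉ [16, 17, 18, 19, 20, 21, 22] → s'.reg r = s.reg r) M trivial h15 hK
    ⟨∅, _, _, rfl, Greedy.Inv.start, h, fun _ _ => rfl⟩ ?_ ?_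
  · rintro i hi s' ⟨done, x, R, rfl, hinv, hrec, hr⟩
    refine wp_mono _ ?_ (wp_greedyStep hK hrec hinv hi ((hr 13 (by decide)).trans h13)
      ((hr 15 (by decide)).trans h15))
    rintro s'' ⟨done', x', R', hcard, hinv', hrec', hr'⟩
    exact ⟨done', x', R', hcard, hinv', hrec', fun r hmem => (hr' r hmem).trans (hr r hmem)⟩
  · rintro s' ⟨done, x, R, hcard, hinv, hrec, hr⟩
    obtain rfl : done = Finset.range M :=
      Finset.eq_of_subset_of_card_le hinv.subset (by simp [hcard])
    exact hQ s' x R hinv hrec hr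

/-- The records that have been written while reading the instance describe its items. -/
theorem exists_items {mem : ℕ → ℕ}
    (h : ∀ k : Fin I.nE, SegAt mem (base + 16 * k) (itemBlock I k)) :
    ∃ w m T L D r cap, IsItems I w m T L cap ∧ (∀ k : Fin I.nE, D (2 * k) = I.demand k) ∧
      (∀ k : Fin I.nE, r (2 * k) = I.maxRate k) ∧
      Records base (2 * I.nE) w m T L D r ∅ (fun _ => 0) cap mem := by
  have even : ∀ (k : Fin I.nE) (f : ℕ) (hf : f < 16),
      mem (base + 8 * (2 * k) + f) = (itemBlock I k)[f]'hf := fun k f hf => by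
    rw [← h k f hf]
    congr 1
    ring
  have odd : ∀ (k : Fin I.nE) (f : ℕ) (hf : 8 + f < 16),
      mem (base + 8 * (2 * k + 1) + f) = (itemBlock I k)[8 + f]'hf := fun k f hf => by
    rw [← h k (8 + f) hf]
    congr 1
    ring
  -- All item data are read off from memory; the subtraction undoes the shift of the weights.
  refine ⟨fun i => mem (base + 8 * i) - 1, fun i => mem (base + 8 * i + 1),
    fun i => mem (base + 8 * i + 2), fun i => mem (base + 8 * i + 3),
    fun i => mem (base + 8 * i + 6), fun i => mem (base + 8 * i + 7),
    fun i => mem (base + 8 * i + 4), ⟨fun k => ?_, fun k => even k 1 (by omega), fun k => ?_,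
    fun k => odd k 1 (by omega), fun k => even k 2 (by omega), fun k => odd k 2 (by omega),
    fun k => even k 3 (by omega), fun k => odd k 3 (by omega), fun k => even k 4 (by omega),
    fun k => odd k 4 (by omega)⟩, fun k => even k 6 (by omega), fun k => even k 7 (by omega),
    ⟨fun i hi => ?_, fun _ _ => rfl, fun _ _ => rfl, fun _ _ => rfl, fun _ _ => rfl,
      fun i hi => ?_, fun _ _ => rfl, fun _ _ => rfl⟩⟩
  · have := even k 0 (by omega)
    rw [add_zero] at this
    simp only [this]
    rfl
  · have := odd k 0 (by omega)
    rw [add_zero] at this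
    simp only [this]
    rfl
  · obtain ⟨k, rfl | rfl⟩ : ∃ k : Fin I.nE, i = 2 * k ∨ i = 2 * k + 1 :=
      ⟨⟨i / 2, by omega⟩, by simp only; omega⟩
    · have := even k 0 (by omega)
      rw [add_zero] at this
      simp [this, itemBlock]
    · have := odd k 0 (by omega)
      rw [add_zero] at this
      simp [this, itemBlock]
  · obtain ⟨k, rfl | rfl⟩ : ∃ k : Fin I.nE, i = 2 * k ∨ i = 2 * k + 1 :=
      ⟨⟨i / 2, by omega⟩, by simp only; omega⟩
    · exact even k 5 (by omega)
    · exact odd k 5 (by omega)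

/-- Justifies the annotated product bound in `writeArea`: the last, partial time step overshoots the
demand by at most one full rate, which is at most the demand. -/
theorem IsItems.flow_bound (h : IsItems I w m T L cap) (hx : ∀ i, x i ≤ m i) (k : Fin I.nE) :
    (x (2 * k) + x (2 * k + 1)) * I.maxRate k ≤ I.demand k + I.demand k := by
  have h₁ := hx (2 * k)
  have h₂ := hx (2 * k + 1)
  rw [h.m_even] at h₁
  rw [h.m_odd] at h₂
  have h₃ : I.maxRate k ≤ I.demand k := (I.maxRate_eq k).trans_le (min_le_left _ _)
  rw [add_mul]
  refine add_le_add ((Nat.mul_le_mul_right _ h₁).trans (Nat.div_mul_le_self _ _)) ?_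
  calc x (2 * k + 1) * I.maxRate k ≤ 1 * I.maxRate k :=
        Nat.mul_le_mul_right _ (h₂.trans (min_le_left _ _))
    _ ≤ I.demand k := by simpa using h₃

theorem wp_solve (hc : I.Convergent) (hs : I.SameCompletion) (hK : 2 * I.encode.length ≤ K) :
    solve.wp K (fun s => ∃ A, Solves I A ∧ s.output = A.encode) (init I.encode) := by
  have hmem := segAt_init I.encode
  obtain ⟨m0, m3, m4⟩ := Instance.segAt_header hmem
  have hlen := I.nE_le_length
  have r0 : (init I.encode).reg 0 = I.encode.length := rfl
  simp only [solve, wp_seq, wp_set, ok_mem, ok_lit, ok_var, ok_add, ok_times8, true_and, and_self]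
  -- The records start at eight times the input length: beyond the input, and beyond the `1 + 5 *
  -- nE` cells of the output.
  refine wp_rep (HasRead I (8 * I.encode.length)) I.nE trivial (by simp [m0]) (by omega) ?_
    (fun i hi s h => wp_readArea ⟨i, hi⟩ (by omega) (by omega) h) fun s h => ?_
  · constructor
    · exact hmem
    · simp [r0]
    · simp [m0]
    · simp [m4]
    · simp [r0]
    · simp [m3, Instance.areaAddr]
    · simp [r0]
    · simp
    · simp
  refine ⟨trivial, fun h5 => ?_, fun h5 => ?_⟩
  · rw [eval_var, Ne, h.reg5, not_not] at h5
    have hadm : Admissible I := fun k => h5 k k.2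
    obtain ⟨w, m, T, L, D, r, cap, hitems, hD, hr, hrec⟩ := exists_items fun k => h.items k k.2
    simp only [wp_seq, wp_set, ok_var, ok_add, true_and, and_self]
    refine wp_greedy (M := 2 * I.nE) (by omega) hrec (by simp [h.reg13])
      (by simp [h.reg1, two_mul]) fun s' x R hinv hrec' hr' => ?_
    refine wp_mono _ ?_ (wp_writeSchedule (by omega) (by omega) (hitems.flow_bound hinv.le) hD hr
      hrec' ?_ ?_)
    · exact fun s'' hs'' => ⟨_, .inl ⟨_, rfl, hitems.isOptimal hc hs hadm hinv⟩, hs''⟩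
    · rw [hr' 1 (by decide)]
      simp [h.reg1]
    · rw [hr' 13 (by decide)]
      simp [h.reg13]
  · rw [eval_var, h.reg5] at h5
    simp only [wp_seq, wp_set, wp_store, ok_lit, true_and]
    refine ⟨none, .inr ⟨rfl, fun S hS => h5 fun k _ => hS.admissible k⟩, ?_⟩
    exact State.output_eq (by simp [SegAt, Answer.encode]) (by simp [Answer.encode])

end Evacuation

theorem theorem3 :
    Ram.SolvableInPolyTime Evacuation.Instance.encode Evacuation.Answer.encode
      (fun I : Evacuation.Instance => I.Convergent ∧ I.SameCompletion)
      (fun (I : Evacuation.Instance) (A : Evacuation.Answer) => Evacuation.Solves I A) :=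
  Ram.solvableInPolyTime_of_wp Evacuation.solve fun I hI =>
    Evacuation.wp_solve hI.1 hI.2 (Nat.mul_le_mul_left 2 (Ram.length_le_inputSize I.encode))
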